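/- **Conventions.** $2^{<\omega}$ is the set of finite binary strings, $\preceq$ the prefix relation, $\ast$ concatenation, and $2^{\omega}$ is the Cantor space of infinite binary sequences (streams) with the uniform product measure $\mu$. For $S\subseteq 2^{<\omega}$ let $[\![S]\!]$ be the set of $X\in 2^{\omega}$ with a prefix in $S$, and let $\mu(S):=\mu([\![S]\!])$. Let $\emptyset''$ be the halting problem iterated twice. A Martin-Löf test relative to $\emptyset''$ is a sequence $(U_i)_{i\in\mathbb N}$ of sets of strings, c.e. relative to $\emptyset''$ uniformly in $i$, with $\mu(U_i)\le 2^{-i}$ for all $i$. A real number $\alpha\in[0,1]$ is *3-random* if it has a binary expansion $X\in 2^\omega$ with $X\notin\bigcap_i[\![U_i]\!]$ for every such test. A set $V\subseteq 2^{<\omega}$ is $\Sigma^0_3$ if there is a decidable relation $R$ such that $\sigma\in V\iff\exists a\,\forall b\,\exists c\;R(\sigma,a,b,c)$. **Chaitin's infinitary self-delimiting machines.** Let $M:2^{<\omega}\times\mathbb N\to 2^{<\omega}$ be a partial computable function such that (a) if $M(\sigma,m)$ is defined and $n<m$, then $M(\sigma,n)$ is defined and $M(\sigma,n)\preceq M(\sigma,m)$;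 (b) if $M(\sigma,n)$ is defined then, for every string $\tau$, $M(\sigma\ast\tau,n)$ is defined and equal to $M(\sigma,n)$; (c) it is decidable whether $M(\sigma,n)$ is defined. The infinitary self-delimiting machine $M^\infty$ given by $M$ is defined at $\sigma$ if $M(\sigma,n)$ is defined for all $n$, and then $M^\infty(\sigma)\in 2^{<\omega}\cup 2^\omega$ is the supremum of the strings $M(\sigma,n)$ under the prefix order. Let $\mathrm{DOM}(M^\infty)$ be the set of strings at which $M^\infty$ is defined, and let $\mathrm{DOM}(M^*)$ be the prefix-free set of the $\preceq$-minimal elements of $\mathrm{DOM}(M^\infty)$. **Lemma 1.3.** Let $M^\infty$ be any infinitary self-delimiting machine. 1. If $V\subseteq\mathrm{DOM}(M^*)$ is $\Sigma^0_3$, then $\mu(V)$ is not a 3-random real. 2. More generally, let $V\subseteq\mathrm{DOM}(M^\infty)$ be $\Sigma^0_3$ and such that $\sigma\in V$ whenever $\sigma\preceq\tau$, $\sigma\in\mathrm{DOM}(M^\infty)$ and $\tau\in V$ (for instance, $V=\{\sigma\in \mathrm{DOM}(M^\infty) : M^\infty(\sigma)\in P\}$ for a set $P$ of possible outputs, when this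 $V$ is $\Sigma^0_3$). Then $\mu(V)$ is not a 3-random real. 3. In particular, the measure of the set of strings $\sigma$ such that $M^\infty(\sigma)=\tau\ast 1^\omega$ for some string $\tau$, i.e. the probability that $M^\infty$ outputs a stream with a tail of 1s, is not a 3-random real. (This holds for every such machine, hence for every universal one.) -/

import Mathlib

open MeasureTheory

namespace InfSD

/-! ### Cantor space and its uniform measure -/

/-- `σ ≺ X`: the binary string `σ` is an initial segment of the infinite binary sequence `X`. -/
def IsInitSeg (σ : List Bool) (X : ℕ → Bool) : Prop :=
  ∀ (i : ℕ) (h : i < σ.length), σ[i] = X i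

/-- `⟦S⟧`: the set of infinite binary sequences that have an initial segment in `S`. -/
def cylinderSet (S : Set (List Bool)) : Set (ℕ → Bool) :=
  {X | ∃ σ ∈ S, IsInitSeg σ X}

/-- The uniform (fair coin tossing) product measure on Cantor space. -/
noncomputable def cantorMeasure : Measure (ℕ → Bool) :=
  Measure.infinitePi fun _ : ℕ => (PMF.uniformOfFintype Bool).toMeasure

/-- The measure of a set `S` of strings is the uniform measure of `⟦S⟧`, as a real number. -/
noncomputable def stringMeasure (S : Set (List Bool)) : ℝ :=
  (cantorMeasure (cylinderSet S)).toReal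

/-! ### Oracle computability and the iterated halting problem -/

/-- The characteristic function of `A`, as an oracle. -/
noncomputable def charFun (A : Set ℕ) : ℕ →. ℕ :=
  fun n => open Classical in Part.some (if n ∈ A then 1 else 0)

/-- `B` is computably enumerable relative to the oracle `A`. -/
def CEIn {α : Type} [Primcodable α] (A : Set ℕ) (B : Set α) : Prop :=
  RecursiveIn {charFun A} fun x : α => Part.assert (x ∈ B) fun _ => Part.some ()

/-- Programs for oracle computations on natural numbers. -/
inductive OracleCode : Type
  | zero : OracleCode
  | succ : OracleCode
  | left : OracleCode
  | right : OracleCode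
  | query : OracleCode
  | pair : OracleCode → OracleCode → OracleCode
  | comp : OracleCode → OracleCode → OracleCode
  | prec : OracleCode → OracleCode → OracleCode
  | rfind : OracleCode → OracleCode

namespace OracleCode

/-- The partial function computed by a program with oracle `g`; the clauses are those of
`Nat.RecursiveIn`. -/
def eval (g : ℕ →. ℕ) : OracleCode → ℕ →. ℕ
  | zero => fun _ => Part.some 0
  | succ => fun n => Part.some (n + 1)
  | left => fun n => Part.some (Nat.unpair n).1
  | right => fun n => Part.some (Nat.unpair n).2
  | query => g
  | pair c d => fun n => Nat.pair <$> eval g c n <*> eval g d n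
  | comp c d => fun n => eval g d n >>= eval g c
  | prec c d => fun p =>
      let (a, n) := Nat.unpair p
      n.rec (eval g c a) fun y IH => do
        let i ← IH
        eval g d (Nat.pair a (Nat.pair y i))
  | rfind c => fun a =>
      Nat.rfind fun n => (fun m => m = 0) <$> eval g c (Nat.pair a n)

/-- The index (Gödel number) of a program. -/
def index : OracleCode → ℕ
  | zero => 0
  | succ => 1
  | left => 2
  | right => 3
  | query => 4
  | pair c d => 4 * Nat.pair (index c) (index d) + 5
  | comp c d => 4 * Nat.pair (index c) (index d) + 6
  | prec c d => 4 * Nat.pair (index c) (index d) + 7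
  | rfind c => 4 * index c + 8

theorem index_injective : Function.Injective index := by
  intro c
  induction c with
  | pair c d ihc ihd | comp c d ihc ihd | prec c d ihc ihd =>
    intro e h
    cases e with
    | pair c' d' | comp c' d' | prec c' d' =>
      simp only [index] at h
      first
        | omega
        | have h' : Nat.pair c.index d.index = Nat.pair c'.index d'.index := by omega
          rw [ihc (Nat.pair_eq_pair.1 h').1, ihd (Nat.pair_eq_pair.1 h').2]
    | _ => simp only [index] at h; omega
  | rfind c ih =>
    intro e h
    cases e with
    | rfind c' =>
      simp only [index] at h
      have h' : c.index = c'.index := by omega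
      rw [ih h']
    | _ => simp only [index] at h; omega
  | _ =>
    intro e h
    cases e <;> simp only [index] at h <;> first | rfl | omega

/-- The programs compute exactly the functions that are recursive in the oracle. -/
theorem recursiveIn_iff (g f : ℕ →. ℕ) :
    Nat.RecursiveIn {g} f ↔ ∃ c : OracleCode, eval g c = f := by
  constructor
  · intro h
    induction h with
    | zero => exact ⟨zero, rfl⟩
    | succ => exact ⟨succ, rfl⟩
    | left => exact ⟨left, rfl⟩
    | right => exact ⟨right, rfl⟩
    | oracle k hk => exact ⟨query, (Set.mem_singleton_iff.1 hk).symm⟩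
    | pair _ _ ih₁ ih₂ =>
      obtain ⟨c, rfl⟩ := ih₁
      obtain ⟨d, rfl⟩ := ih₂
      exact ⟨pair c d, rfl⟩
    | comp _ _ ih₁ ih₂ =>
      obtain ⟨c, rfl⟩ := ih₁
      obtain ⟨d, rfl⟩ := ih₂
      exact ⟨comp c d, rfl⟩
    | prec _ _ ih₁ ih₂ =>
      obtain ⟨c, rfl⟩ := ih₁
      obtain ⟨d, rfl⟩ := ih₂
      exact ⟨prec c d, rfl⟩
    | rfind _ ih =>
      obtain ⟨c, rfl⟩ := ih
      exact ⟨rfind c, rfl⟩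
  · rintro ⟨c, rfl⟩
    induction c with
    | zero => exact Nat.RecursiveIn.zero
    | succ => exact Nat.RecursiveIn.succ
    | left => exact Nat.RecursiveIn.left
    | right => exact Nat.RecursiveIn.right
    | query => exact Nat.RecursiveIn.oracle _ rfl
    | pair c d ihc ihd => exact Nat.RecursiveIn.pair ihc ihd
    | comp c d ihc ihd => exact Nat.RecursiveIn.comp ihc ihd
    | prec c d ihc ihd => exact Nat.RecursiveIn.prec ihc ihd
    | rfind c ih => exact Nat.RecursiveIn.rfind ih

end OracleCode

/-- The halting problem relative to `A`: the set of all pairs `⟨e, x⟩` such that the program with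
index `e` and oracle `A` halts on input `x`. -/
def haltingProblem (A : Set ℕ) : Set ℕ :=
  {m | ∃ (c : OracleCode) (x : ℕ),
    m = Nat.pair c.index x ∧ (OracleCode.eval (charFun A) c x).Dom}

/-- `∅⁽ⁿ⁾`: the halting problem iterated `n` times. -/
def iteratedHalting : ℕ → Set ℕ
  | 0 => ∅
  | n + 1 => haltingProblem (iteratedHalting n)

/-! ### Martin-Löf randomness -/

/-- A Martin-Löf test relative to `A`: a sequence of open classes `⟦U i⟧`, given by sets of strings
that are computably enumerable relative to `A` uniformly in `i`, with measures at most `2⁻ⁱ`. -/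
def IsMLTest (A : Set ℕ) (U : ℕ → Set (List Bool)) : Prop :=
  CEIn A {p : ℕ × List Bool | p.2 ∈ U p.1} ∧ ∀ i, stringMeasure (U i) ≤ (1 / 2 : ℝ) ^ i

/-- Martin-Löf randomness of a binary sequence relative to `A`. -/
def IsMLRandom (A : Set ℕ) (X : ℕ → Bool) : Prop :=
  ∀ U : ℕ → Set (List Bool), IsMLTest A U → ∃ i, X ∉ cylinderSet (U i)

/-- `X` is a binary expansion of the real number `α ∈ [0, 1]`. -/
def IsBinaryExpansion (X : ℕ → Bool) (α : ℝ) : Prop :=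
  HasSum (fun i : ℕ => if X i then (1 / 2 : ℝ) ^ (i + 1) else 0) α

/-- A real number is 3-random if it has a binary expansion that is Martin-Löf random relative
to `∅''`. (Numbers with two expansions are rational, and neither expansion is random.) -/
def IsThreeRandom (α : ℝ) : Prop :=
  ∃ X : ℕ → Bool, IsBinaryExpansion X α ∧ IsMLRandom (iteratedHalting 2) X

/-! ### Arithmetical complexity -/

/-- `Σ⁰₃` sets of strings: `σ ∈ V ↔ ∃ a, ∀ b, ∃ c, R σ a b c` with `R` decidable. -/
def IsSigma3 (V : Set (List Bool)) : Prop :=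
  ∃ R : List Bool → ℕ → ℕ → ℕ → Prop,
    ComputablePred (fun p : List Bool × ℕ × ℕ × ℕ => R p.1 p.2.1 p.2.2.1 p.2.2.2) ∧
      ∀ σ, σ ∈ V ↔ ∃ a, ∀ b, ∃ c, R σ a b c

/-! ### Outcomes: finite strings and streams -/

/-- The outcome of an infinitary computation: a finite binary string or a binary stream. -/
inductive Outcome : Type
  | string : List Bool → Outcome
  | stream : (ℕ → Bool) → Outcome

namespace Outcome

/-- The prefix order on strings and streams. -/
def IsPrefix : Outcome → Outcome → Prop
  | string u, string v => u <+: v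
  | string u, stream Y => IsInitSeg u Y
  | stream _, string _ => False
  | stream Y, stream Z => Y = Z

instance : PartialOrder Outcome where
  le := IsPrefix
  le_refl y := by
    cases y with
    | string u => exact List.prefix_rfl
    | stream Y => exact rfl
  le_trans x y z hxy hyz := by
    cases x <;> cases y <;> cases z <;> simp only [IsPrefix] at *
    · exact hxy.trans hyz
    · intro i hi
      rw [← hyz i (hi.trans_le hxy.length_le), hxy.getElem hi]
    · rw [← hyz]; exact hxy
    · exact hxy.trans hyz
  le_antisymm x y hxy hyx := by
    cases x <;> cases y <;> simp only [IsPrefix] at *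
    · rw [hxy.eq_of_length_le hyx.length_le]
    · rw [hxy]

end Outcome

/-! ### Infinitary self-delimiting machines -/

/-- The partial computable functions `M : 2^{<ω} × ℕ → 2^{<ω}` on which infinitary self-delimiting
machines are based. -/
structure Machine where
  /-- The underlying partial function. -/
  run : List Bool → ℕ →. List Bool
  partrec : Partrec₂ run
  mono : ∀ (σ : List Bool) (n m : ℕ) (v : List Bool), n < m → v ∈ run σ m →
    ∃ u ∈ run σ n, u <+: v
  extend : ∀ (σ τ : List Bool) (n : ℕ) (v : List Bool), v ∈ run σ n → v ∈ run (σ ++ τ) n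
  decidable_dom : ComputablePred fun p : List Bool × ℕ => (run p.1 p.2).Dom

namespace Machine

/-- `DOM(M^∞)`: the strings `σ` such that `M(σ, n)` is defined for all `n`. -/
def dom (M : Machine) : Set (List Bool) :=
  {σ | ∀ n, (M.run σ n).Dom}

/-- `DOM(M^*)`: the minimal strings of `DOM(M^∞)`; this set is prefix-free. -/
def minDom (M : Machine) : Set (List Bool) :=
  {σ | σ ∈ M.dom ∧ ∀ τ, τ <+: σ → τ ∈ M.dom → τ = σ}

/-- `M^∞(σ) = y`: the string `σ` is in `DOM(M^∞)` and `y` is the supremum of the strings `M(σ, n)`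
in the prefix order. -/
def Outputs (M : Machine) (σ : List Bool) (y : Outcome) : Prop :=
  σ ∈ M.dom ∧ IsLUB {z | ∃ n, ∃ u ∈ M.run σ n, z = Outcome.string u} y

/-- `COFIN(M^∞)`: the strings `σ` such that `M^∞(σ) = τ * 1^ω` for some string `τ`. -/
def cofin (M : Machine) : Set (List Bool) :=
  {σ | ∃ τ : List Bool, M.Outputs σ (Outcome.stream fun i => τ.getD i true)}

end Machine

end InfSD

/-! Let D = DOM(M^*). Since DOM(M^∞) is Π⁰₁ and closed under extensions, D is decidable in ∅'. A set
V as in the general case has the same measure as V ∩ D (`Machine.stringMeasure_inter_minDom`). So it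
suffices to show, with A = ∅', that if D is prefix-free and decidable in A, then the measure α of
any subset of D that is c.e. in A' is not random relative to A' (`not_isMLRandom_of_subset`).

The weights 2^(-|σ|) of the strings of D form a convergent A-computable series u. That its tail from
e on is at most 2^(-k) is a Π⁰₁ statement relative to A, so A' decides it. Counting the k < e that
qualify gives an A'-computable q with q(e) → ∞ and ∑ q(e) u(e) ≤ 1 (`sum_tailCount_mul_le`). Reading
q at the code of each listed string, A' enumerates the subset so that α = ∑ w_t, where ∑ q_t w_t ≤ 1
and q_t → ∞ along the listed strings.

Such an α is captured by a test (`not_isMLRandom_of_acceleration`). For the n-th member, a marker r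
starts at 0 and jumps at stage t to max(r, current partial sum) + 2^(-(n+3)) (q_t w_t + 2^(-(t+1)));
the added piece is covered. The pieces have total length at most 2^(-(n+2)), and dyadic rounding
costs a factor of at most 3. If no piece contained α, the marker would stay at or below α. But once
q_t ≥ 2^(n+3) on the listed strings, the marker advances by at least w_t at each stage, so it keeps
a fixed positive lead over the partial sums and must pass their limit α (`exists_capture`). -/

namespace InfSD

open Encodable

/-! ### Relative computability, and quantifier elimination by the jump. -/

section Oracle

variable {α β σ : Type*} [Primcodable α] [Primcodable β] [Primcodable σ]
variable {O : Set (ℕ →. ℕ)}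

theorem _root_.RecursiveIn.comp {f : β →. σ} {g : α → β} (hf : RecursiveIn O f)
    (hg : ComputableIn O g) : RecursiveIn O fun a => f (g a) :=
  (Nat.RecursiveIn.comp hf hg).of_eq fun n => by
    rcases e : decode (α := α) n with - | a <;> simp [encodek]

theorem _root_.ComputableIn.comp {f : β → σ} {g : α → β} (hf : ComputableIn O f)
    (hg : ComputableIn O g) : ComputableIn O fun a => f (g a) :=
  RecursiveIn.comp (f := fun b => Part.some (f b)) hf hg

theorem _root_.ComputableIn.pair {f : α → β} {g : α → σ} (hf : ComputableIn O f)
    (hg : ComputableIn O g) : ComputableIn O fun a => (f a, g a) :=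
  (Nat.RecursiveIn.pair hf hg).of_eq fun n => by
    rcases e : decode (α := α) n with - | a <;> simp [Seq.seq]

theorem _root_.ComputableIn.of_eq {f g : α → σ} (hf : ComputableIn O f) (h : ∀ a, f a = g a) :
    ComputableIn O g := (funext h : f = g) ▸ hf

theorem _root_.ComputableIn.comp_computable {f : β → σ} {g : α → β} (hf : Computable f)
    (hg : ComputableIn O g) : ComputableIn O fun a => f (g a) :=
  ComputableIn.comp hf.computableIn hg

theorem _root_.ComputableIn.nat_rec {f : α → ℕ} {g : α → σ} {h : α × ℕ × σ → σ}
    (hf : ComputableIn O f) (hg : ComputableIn O g) (hh : ComputableIn O h) :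
    ComputableIn O fun a => Nat.rec (motive := fun _ => σ) (g a) (fun y IH => h (a, y, IH)) (f a) := by
  have hid : ComputableIn O (id : α → α) := Computable.id.computableIn
  have hp := ComputableIn.pair hid hf
  refine (Nat.RecursiveIn.comp (Nat.RecursiveIn.prec hg hh) hp).of_eq fun n => ?_
  rcases e : decode (α := α) n with - | a
  · simp
  · simp only [Part.coe_some, Part.bind_some, id, Part.map_some, encode_prod_val, Part.bind_eq_bind,
      Nat.unpair_pair, encodek]
    induction f a with
    | zero => simp
    | succ m ih =>
      change Part.bind (Nat.rec _ _ m) _ = _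
      simp only at ih ⊢
      have ih' := ih.trans (by rfl : _ = Part.some (encode (Nat.rec (motive := fun _ => σ) (g a) (fun y IH => h (a, y, IH)) m)))
      erw [ih']
      simp [encodek]

theorem _root_.ComputableIn.cond {c : α → Bool} {f g : α → σ} (hc : ComputableIn O c)
    (hf : ComputableIn O f) (hg : ComputableIn O g) :
    ComputableIn O fun a => bif c a then f a else g a :=
  ComputableIn.comp_computable (f := fun p : Bool × σ × σ => bif p.1 then p.2.1 else p.2.2)
    (Computable.cond .fst (.comp .fst .snd) (.comp .snd .snd)) (.pair hc (.pair hf hg))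

open Classical in
/-- The predicate `p` is decidable relative to the oracle `A`. -/
def DecIn (A : Set ℕ) (p : α → Prop) : Prop :=
  ComputableIn {charFun A} fun a => decide (p a)

namespace DecIn

variable {A : Set ℕ} {p q : α → Prop}

theorem of_computablePred (hp : ComputablePred p) : DecIn A p := by
  classical
  exact hp.decide.computableIn

theorem of_eq (hp : DecIn A p) (h : ∀ a, p a ↔ q a) : DecIn A q :=
  (funext fun a => propext (h a) : p = q) ▸ hp

theorem comp {p : β → Prop} {g : α → β} (hp : DecIn A p) (hg : ComputableIn {charFun A} g) :
    DecIn A fun a => p (g a) :=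
  ComputableIn.comp hp hg

theorem comp_computable {p : β → Prop} {g : α → β} (hp : DecIn A p) (hg : Computable g) :
    DecIn A fun a => p (g a) := hp.comp hg.computableIn

theorem not (hp : DecIn A p) : DecIn A fun a => ¬ p a :=
  (ComputableIn.comp_computable (f := Bool.not) Primrec.not.to_comp hp).of_eq fun a => by simp

theorem and (hp : DecIn A p) (hq : DecIn A q) : DecIn A fun a => p a ∧ q a :=
  (ComputableIn.comp_computable (f := fun b : Bool × Bool => b.1 && b.2) Primrec.and.to_comp
    (.pair hp hq)).of_eq fun a => by by_cases h : p a <;> simp [h]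

theorem or (hp : DecIn A p) (hq : DecIn A q) : DecIn A fun a => p a ∨ q a :=
  (hp.not.and hq.not).not.of_eq fun a => by tauto

open Classical in
theorem ite (hp : DecIn A p) {f g : α → σ} (hf : ComputableIn {charFun A} f)
    (hg : ComputableIn {charFun A} g) : ComputableIn {charFun A} fun a => if p a then f a else g a :=
  (ComputableIn.cond hp hf hg).of_eq fun a => by by_cases h : p a <;> simp [h]

theorem exists_lt {p : α × ℕ → Prop} (hp : DecIn A p) :
    DecIn A fun x : α × ℕ => ∃ m < x.2, p (x.1, m) := by
  classical
  have hh : ComputableIn {charFun A}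
      fun y : (α × ℕ) × ℕ × Bool => y.2.2 || decide (p (y.1.1, y.2.1)) := by
    have h₁ : DecIn A fun y : (α × ℕ) × ℕ × Bool => p (y.1.1, y.2.1) :=
      hp.comp_computable (g := fun y : (α × ℕ) × ℕ × Bool => (y.1.1, y.2.1))
        (.pair (.comp .fst .fst) (.comp .fst .snd))
    have h₂ : ComputableIn {charFun A} fun y : (α × ℕ) × ℕ × Bool => y.2.2 :=
      (Computable.comp .snd .snd).computableIn
    refine (ComputableIn.comp_computable (f := fun b : Bool × Bool => b.1 || b.2)
      Primrec.or.to_comp (ComputableIn.pair h₂ h₁)).of_eq fun y => ?_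
    simp only
  refine (ComputableIn.nat_rec (f := fun x : α × ℕ => x.2) (g := fun _ => false)
    Computable.snd.computableIn (Computable.const _).computableIn hh).of_eq ?_
  rintro ⟨a, n⟩
  induction n with
  | zero => simp
  | succ n ih =>
    simp only at ih
    simp only [ih]
    rw [← Bool.decide_or]
    simp only [Nat.lt_succ_iff_lt_or_eq, or_and_right, exists_or, exists_eq_left]

theorem bind_rfind {p : ℕ → Prop} (F : ℕ →. Bool)
    (h : ∀ n, F n = Part.some (open Classical in decide (p n))) :
    ((Nat.rfind F).bind fun _ => Part.some 0) = Part.assert (∃ n, p n) fun _ => Part.some 0 := by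
  classical
  have hd : (Nat.rfind F).Dom ↔ ∃ n, p n := by
    rw [Nat.rfind_dom]
    constructor
    · rintro ⟨n, h', -⟩
      exact ⟨n, by simpa [h] using h'⟩
    · rintro ⟨n, h'⟩
      exact ⟨n, by simpa [h] using h', fun _ => by rw [h]; trivial⟩
  ext m
  simp only [Part.mem_bind_iff, Part.mem_assert_iff, Part.mem_some_iff, exists_prop,
    exists_and_right, ← hd, Part.dom_iff_mem]

/-- Unbounded search for a witness to a decidable predicate. -/
theorem recursiveIn_exists {p : α × ℕ → Prop} (hp : DecIn A p) :
    RecursiveIn {charFun A} fun a => Part.assert (∃ n, p (a, n)) fun _ => Part.some () := by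
  classical
  have h : ComputableIn {charFun A} fun x : α × ℕ => if p x then 0 else 1 :=
    hp.ite (Computable.const 0).computableIn (Computable.const 1).computableIn
  refine (Nat.RecursiveIn.comp .zero (Nat.RecursiveIn.rfind h)).of_eq fun n => ?_
  rcases e : decode (α := α) n with - | a
  -- If `n` codes no element of `α`, the search diverges at its first query.
  · have : (fun m : ℕ => (fun m => decide (m = 0)) <$>
        (((decode (α := α × ℕ) (Nat.pair n m) : Option (α × ℕ)) : Part (α × ℕ)).bind fun x =>
          (Part.some (if p x then 0 else 1)).map encode) : ℕ →. Bool) 0 = Part.none := by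
      simp [e]
    refine (congrArg (Part.bind · _) (Nat.rfind_zero_none _ this)).trans ?_
    simp
  · refine (bind_rfind (p := fun m => p (a, m)) _ fun m => ?_).trans ?_
    · by_cases h : p (a, m) <;> simp [h, e]
    · ext m
      simp only [Part.coe_some, Part.bind_some, Part.mem_assert_iff, Part.mem_map_iff,
        Part.mem_some_iff, exists_prop]
      constructor
      · rintro ⟨h, rfl⟩
        exact ⟨(), ⟨h, trivial⟩, rfl⟩
      · rintro ⟨_, ⟨h, -⟩, rfl⟩
        exact ⟨h, rfl⟩

/-- A set that is c.e. relative to `A` is decidable relative to the jump of `A`. -/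
theorem exists_jump {p : α × ℕ → Prop} (hp : DecIn A p) :
    DecIn (haltingProblem A) fun a => ∃ n, p (a, n) := by
  classical
  obtain ⟨c, hc⟩ := (OracleCode.recursiveIn_iff _ _).1 hp.recursiveIn_exists
  have hH : ComputableIn {charFun (haltingProblem A)}
      fun n => if n ∈ haltingProblem A then 1 else 0 :=
    RecursiveIn.of_eq (RecursiveIn.oracle _ rfl) fun n => by simp [charFun]
  have hH' : DecIn (haltingProblem A) fun n => n ∈ haltingProblem A :=
    (ComputableIn.comp_computable (f := fun n : ℕ => decide (n = 1))
      (Primrec.eq.comp .id (.const 1)).decide.to_comp hH).of_eq fun n => by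
        by_cases h : n ∈ haltingProblem A <;> simp [h]
  -- The query to the jump: does the search program `c` halt on the code of `a`?
  refine (hH'.comp_computable (g := fun a : α => Nat.pair c.index (encode a))
    (Primrec₂.natPair.comp (.const _) .encode).to_comp).of_eq fun a => ?_
  have key : (OracleCode.eval (charFun A) c (encode a)).Dom ↔ ∃ n, p (a, n) := by
    simp [hc, Part.assert]
  rw [← key]
  constructor
  · rintro ⟨d, x, h, hd⟩
    obtain ⟨h₁, rfl⟩ := Nat.pair_eq_pair.1 h
    rwa [OracleCode.index_injective h₁]
  · exact fun h => ⟨c, _, rfl, h⟩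

theorem forall_jump {p : α × ℕ → Prop} (hp : DecIn A p) :
    DecIn (haltingProblem A) fun a => ∀ n, p (a, n) :=
  hp.not.exists_jump.not.of_eq fun a => by simp

theorem jump (hp : DecIn A p) : DecIn (haltingProblem A) p :=
  (exists_jump (p := fun x : α × ℕ => p x.1) (hp.comp_computable .fst)).of_eq fun a => by simp

theorem ceIn {α : Type} [Primcodable α] {B : Set α} (hB : DecIn A (· ∈ B)) : CEIn A B :=
  RecursiveIn.of_eq (recursiveIn_exists (p := fun x : α × ℕ => x.1 ∈ B) (hB.comp_computable .fst))
    fun a => by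
      rw [show (∃ _ : ℕ, a ∈ B) = (a ∈ B) from propext (exists_const ℕ)]

end DecIn

end Oracle

end InfSD

namespace InfSD

/-! ### Measures of cylinders, prefix-free sums and binary values. -/

section Measure

open scoped ENNReal

instance : IsProbabilityMeasure cantorMeasure := by unfold cantorMeasure; infer_instance

/-- The set of sequences extending `σ`. -/
def cyl (σ : List Bool) : Set (ℕ → Bool) := {X | IsInitSeg σ X}

theorem cyl_eq_pi (σ : List Bool) :
    cyl σ = Set.pi (Finset.range σ.length) fun i => {σ.getD i false} := by
  ext X
  simp only [cyl, IsInitSeg, Set.mem_ofPred_eq, Set.mem_pi, Finset.coe_range, Set.mem_Iio,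
    Set.mem_singleton_iff]
  refine forall_congr' fun i => forall_congr' fun h => ?_
  rw [List.getD_eq_getElem _ _ h, eq_comm]

theorem measurableSet_cyl (σ : List Bool) : MeasurableSet (cyl σ) := by
  rw [cyl_eq_pi]
  exact MeasurableSet.pi (Finset.countable_toSet _) fun _ _ => MeasurableSet.of_discrete

theorem cantorMeasure_cyl (σ : List Bool) : cantorMeasure (cyl σ) = 2⁻¹ ^ σ.length := by
  rw [cyl_eq_pi, cantorMeasure, Measure.infinitePi_pi _ fun _ _ => MeasurableSet.of_discrete]
  simp

theorem prefix_of_isInitSeg {σ τ : List Bool} {X : ℕ → Bool} (hσ : IsInitSeg σ X)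
    (hτ : IsInitSeg τ X) (h : σ.length ≤ τ.length) : σ <+: τ := by
  rw [List.prefix_iff_eq_take]
  refine List.ext_getElem (by simp [h]) fun i h₁ h₂ => ?_
  rw [List.getElem_take, hσ i h₁, hτ i (h₁.trans_le h)]

theorem IsInitSeg.of_prefix {σ τ : List Bool} {X : ℕ → Bool} (h : σ <+: τ)
    (hτ : IsInitSeg τ X) : IsInitSeg σ X := fun i hi => by
  rw [← hτ i (hi.trans_le h.length_le), h.getElem hi]

/-- The measure of the cylinder of an optional string. -/
noncomputable def weight (o : Option (List Bool)) : ℝ :=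
  o.elim 0 fun σ => (1 / 2 : ℝ) ^ σ.length

theorem weight_nonneg (o : Option (List Bool)) : 0 ≤ weight o := by
  cases o <;> simp [weight]

/-- An enumeration without repetitions of a prefix-free set. -/
def PrefixFree (f : ℕ → Option (List Bool)) : Prop :=
  ∀ s t σ τ, f s = some σ → f t = some τ → σ <+: τ → s = t

theorem PrefixFree.hasSum {f : ℕ → Option (List Bool)} (hf : PrefixFree f) :
    HasSum (fun t => weight (f t)) (stringMeasure {σ | ∃ t, f t = some σ}) := by
  let c : ℕ → Set (ℕ → Bool) := fun t => (f t).elim ∅ cyl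
  have hc : ∀ t, cantorMeasure (c t) = ENNReal.ofReal (weight (f t)) := fun t => by
    simp only [c, weight]
    rcases f t with - | σ
    · simp
    · simp [cantorMeasure_cyl, ENNReal.ofReal_inv_of_pos, ENNReal.inv_pow]
  have hm : ∀ t, MeasurableSet (c t) := fun t => by
    simp only [c]
    rcases f t with - | σ
    · simp
    · exact measurableSet_cyl σ
  have hd : Pairwise (Function.onFun Disjoint c) := fun s t hst => by
    refine Set.disjoint_left.2 fun X hs ht => hst ?_
    simp only [c] at hs ht
    rcases es : f s with - | σ
    · simp [es] at hs
    rcases et : f t with - | τ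
    · simp [et] at ht
    rw [es] at hs
    rw [et] at ht
    rcases le_total σ.length τ.length with h | h
    · exact hf _ _ _ _ es et (prefix_of_isInitSeg hs ht h)
    · exact (hf _ _ _ _ et es (prefix_of_isInitSeg ht hs h)).symm
  have hU : cylinderSet {σ | ∃ t, f t = some σ} = ⋃ t, c t := by
    ext X
    simp only [cylinderSet, Set.mem_ofPred_eq, Set.mem_iUnion, c]
    constructor
    · rintro ⟨σ, ⟨t, h⟩, hX⟩
      exact ⟨t, by rw [h]; exact hX⟩
    · rintro ⟨t, h⟩
      rcases e : f t with - | σ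
      · simp [e] at h
      · exact ⟨σ, ⟨t, e⟩, by rw [e] at h; exact h⟩
  have hs := measure_iUnion (μ := cantorMeasure) hd hm
  rw [stringMeasure, hU, hs]
  have hne : ∑' t, cantorMeasure (c t) ≠ ∞ := hs ▸ measure_ne_top _ _
  have := ENNReal.hasSum_toReal hne
  rw [← ENNReal.tsum_toReal_eq fun t => measure_ne_top _ _] at this
  simpa only [hc, ENNReal.toReal_ofReal (weight_nonneg _)] using this

theorem cylinderSet_mono {S T : Set (List Bool)} (h : S ⊆ T) : cylinderSet S ⊆ cylinderSet T :=
  fun _ ⟨σ, hσ, hX⟩ => ⟨σ, h hσ, hX⟩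

theorem stringMeasure_iUnion_le {S : ℕ → Set (List Bool)} {u : ℕ → ℝ} {c : ℝ}
    (h : ∀ t, stringMeasure (S t) ≤ u t) (hu : ∀ n, ∑ t ∈ Finset.range n, u t ≤ c) :
    stringMeasure (⋃ t, S t) ≤ c := by
  have hc : 0 ≤ c := by simpa using hu 0
  have h0 : ∀ t, 0 ≤ u t := fun t => ENNReal.toReal_nonneg.trans (h t)
  refine ENNReal.toReal_le_of_le_ofReal hc ?_
  have hU : cylinderSet (⋃ t, S t) = ⋃ t, cylinderSet (S t) := by
    ext X
    simp only [cylinderSet, Set.mem_ofPred_eq, Set.mem_iUnion]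
    aesop
  rw [hU]
  refine (measure_iUnion_le _).trans (ENNReal.tsum_le_of_sum_range_le fun n => ?_)
  refine le_trans (Finset.sum_le_sum fun t _ => ?_) ((ENNReal.ofReal_sum_of_nonneg
    (s := Finset.range n) fun t _ => h0 t).symm.trans_le (ENNReal.ofReal_le_ofReal (hu n)))
  exact (ENNReal.le_ofReal_iff_toReal_le (measure_ne_top _ _) (h0 t)).2 (h t)

/-! ### Binary values -/

/-- The natural number with binary digits `σ`, the most significant digit first. -/
def binVal (σ : List Bool) : ℕ := σ.foldl (fun a b => 2 * a + b.toNat) 0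

theorem binVal_concat (σ : List Bool) (b : Bool) :
    binVal (σ ++ [b]) = 2 * binVal σ + b.toNat := by
  simp [binVal]

theorem binVal_injective : ∀ {σ τ : List Bool}, σ.length = τ.length → binVal σ = binVal τ → σ = τ := by
  intro σ
  induction σ using List.reverseRecOn with
  | nil => intro τ h _; exact (List.length_eq_zero_iff.1 h.symm).symm
  | append_singleton σ b ih =>
    intro τ h hv
    rcases List.eq_nil_or_concat' τ with rfl | ⟨τ', b', rfl⟩
    · simp at h
    · simp only [List.length_append, List.length_singleton, Nat.add_right_cancel_iff] at h
      rw [binVal_concat, binVal_concat] at hv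
      have hb : b = b' := by
        cases b <;> cases b' <;> simp at hv ⊢ <;> omega
      subst hb
      rw [ih h (by omega)]

/-- Strings of one length are determined by their values, so each value in the window contributes at
most one cylinder, of measure `2⁻ᵐ`. -/
theorem stringMeasure_binVal_le (m a b : ℕ) :
    stringMeasure {σ | σ.length = m ∧ a ≤ binVal σ ∧ binVal σ ≤ b} ≤
      ((b + 1 - a : ℕ) : ℝ) * (1 / 2) ^ m := by
  refine ENNReal.toReal_le_of_le_ofReal (by positivity) ?_
  have hsub : cylinderSet {σ | σ.length = m ∧ a ≤ binVal σ ∧ binVal σ ≤ b} ⊆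
      ⋃ v ∈ Finset.Icc a b, cylinderSet {σ | σ.length = m ∧ binVal σ = v} := by
    rintro X ⟨σ, ⟨h₁, h₂, h₃⟩, hX⟩
    simp only [Set.mem_iUnion, Finset.mem_Icc]
    exact ⟨_, ⟨h₂, h₃⟩, σ, ⟨h₁, rfl⟩, hX⟩
  have hone : ∀ v, cantorMeasure (cylinderSet {σ | σ.length = m ∧ binVal σ = v}) ≤ 2⁻¹ ^ m := by
    intro v
    by_cases h : ∃ σ : List Bool, σ.length = m ∧ binVal σ = v
    · obtain ⟨σ, hl, hv⟩ := h
      rw [← hl, ← cantorMeasure_cyl]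
      refine measure_mono ?_
      rintro X ⟨τ, ⟨h₁, h₂⟩, hX⟩
      rwa [binVal_injective (h₁.trans rfl) (h₂.trans hv.symm)] at hX
    · rw [show cylinderSet {σ | σ.length = m ∧ binVal σ = v} = ∅ from
        Set.eq_empty_of_forall_notMem fun X ⟨σ, hσ, _⟩ => h ⟨σ, hσ⟩]
      simp
  calc _ ≤ _ := measure_mono hsub
    _ ≤ ∑ v ∈ Finset.Icc a b, _ := measure_biUnion_finset_le _ _
    _ ≤ ∑ v ∈ Finset.Icc a b, 2⁻¹ ^ m := Finset.sum_le_sum fun v _ => hone v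
    _ = _ := by
      rw [Finset.sum_const, Nat.card_Icc, nsmul_eq_mul, ENNReal.ofReal_mul (by positivity),
        ENNReal.ofReal_natCast, ENNReal.ofReal_pow (by positivity)]
      simp [ENNReal.ofReal_inv_of_pos]

theorem isInitSeg_range_map (X : ℕ → Bool) (m : ℕ) : IsInitSeg ((List.range m).map X) X := by
  intro i hi
  simp

theorem binVal_range_map (X : ℕ → Bool) (m : ℕ) : (binVal ((List.range m).map X) : ℝ) =
    2 ^ m * ∑ i ∈ Finset.range m, if X i then (1 / 2 : ℝ) ^ (i + 1) else 0 := by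
  induction m with
  | zero => simp [binVal]
  | succ m ih =>
    rw [List.range_succ, List.map_append, List.map_singleton, binVal_concat, Finset.sum_range_succ]
    push_cast
    rw [ih, mul_add, pow_succ]
    congr 1
    · ring
    · cases X m
      · simp
      · simp only [Bool.toNat_true, Nat.cast_one, if_true]
        rw [one_div, inv_pow, ← pow_succ, mul_inv_cancel₀ (by positivity)]

/-- The initial segment of length `m` of a binary expansion of `α` approximates `α`. -/
theorem IsBinaryExpansion.binVal_bounds {X : ℕ → Bool} {α : ℝ} (h : IsBinaryExpansion X α)
    (m : ℕ) : (binVal ((List.range m).map X) : ℝ) ≤ 2 ^ m * α ∧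
      2 ^ m * α ≤ binVal ((List.range m).map X) + 1 := by
  have h' : HasSum (fun i : ℕ => if X i then (1 / 2 : ℝ) ^ (i + 1) else 0) α := h
  have h0 : ∀ i, 0 ≤ if X i then (1 / 2 : ℝ) ^ (i + 1) else 0 := fun i => by split <;> positivity
  rw [binVal_range_map]
  constructor
  · gcongr
    exact sum_le_hasSum _ (fun i _ => h0 i) h'
  · have hg : HasSum (fun i : ℕ => (1 / 2 : ℝ) ^ (i + m + 1)) ((1 / 2) ^ m) := by
      have := (hasSum_geometric_two).mul_left ((1 / 2 : ℝ) ^ (m + 1))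
      rw [show (1 / 2 : ℝ) ^ (m + 1) * 2 = (1 / 2) ^ m by ring] at this
      exact this.congr_fun fun i => by ring
    have ht := (hasSum_nat_add_iff' m).2 h'
    have hle := hasSum_le (fun i => by split <;> [exact le_rfl; positivity]) ht hg
    have h2 : (2 : ℝ) ^ m * (1 / 2) ^ m = 1 := by rw [← mul_pow]; norm_num
    nlinarith [pow_pos (two_pos : (0 : ℝ) < 2) m]

end Measure

end InfSD

namespace InfSD

/-! ### A Martin-Löf test from a computable acceleration of a series. -/

section Test

/-- A sequence `r` that runs ahead of the partial sums of `∑ w` with total waste `c * ∑ q * w`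
cannot stay below the sum if `q` is eventually large. -/
theorem exists_capture {w q r : ℕ → ℝ} {α c : ℝ} (hw : HasSum w α) (hw0 : ∀ t, 0 ≤ w t)
    (hc : 0 < c) (hq : ∃ T, ∀ t ≥ T, w t ≤ c * (q t * w t)) (hq0 : ∀ t, 0 ≤ q t) (hr0 : r 0 = 0)
    (hr : ∀ t, r (t + 1) = max (r t) (∑ s ∈ Finset.range (t + 1), w s) +
      c * (q t * w t + (1 / 2) ^ (t + 1))) :
    ∃ t, max (r t) (∑ s ∈ Finset.range (t + 1), w s) ≤ α ∧ α < r (t + 1) := by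
  by_contra! hcon
  have hle : ∀ t, ∑ s ∈ Finset.range t, w s ≤ α := fun t => sum_le_hasSum _ (fun i _ => hw0 i) hw
  have hrα : ∀ t, r t ≤ α := by
    intro t
    induction t with
    | zero => simpa [hr0] using hle 0
    | succ t ih => exact hcon t (max_le ih (hle _))
  obtain ⟨T, hT⟩ := hq
  -- The lead gained at stage `T`, which later stages never lose. It is positive even if `w T = 0`,
  -- thanks to the extra summand `(1 / 2) ^ (t + 1)` in the jump.
  have hε : 0 < c * (1 / 2 : ℝ) ^ (T + 1) := by positivity
  have key : ∀ j, ∑ s ∈ Finset.range (T + 1 + j), w s + c * (1 / 2) ^ (T + 1) ≤ r (T + 1 + j) := by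
    intro j
    induction j with
    | zero =>
      rw [add_zero, hr]
      have h₁ := le_max_right (r T) (∑ s ∈ Finset.range (T + 1), w s)
      have h₂ : 0 ≤ c * (q T * w T) := mul_nonneg hc.le (mul_nonneg (hq0 T) (hw0 T))
      linarith
    | succ j ih =>
      rw [← add_assoc, hr, Finset.sum_range_succ]
      have h₁ := le_max_left (r (T + 1 + j)) (∑ s ∈ Finset.range (T + 1 + j + 1), w s)
      have h₂ := hT (T + 1 + j) (by omega)
      have h₃ : 0 ≤ c * (1 / 2 : ℝ) ^ (T + 1 + j + 1) := by positivity
      rw [Finset.sum_range_succ] at h₁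
      linarith
  have hlt : α - c * (1 / 2 : ℝ) ^ (T + 1) < α := by linarith
  obtain ⟨N, hN⟩ := ((hw.tendsto_sum_nat.eventually (lt_mem_nhds hlt)).and
    (Filter.eventually_ge_atTop (T + 1))).exists
  obtain ⟨j, rfl⟩ := Nat.exists_eq_add_of_le hN.2
  linarith [key j, hrα (T + 1 + j), hN.1]

/-- One step of `coverState`, with the stage data `d = (W t, q t)`. -/
def coverStep (n : ℕ) (s d : ℕ × ℕ) : ℕ × ℕ :=
  (2 * (s.1 + d.1),
    max (2 * s.2) (2 ^ (n + 4) * (2 * (s.1 + d.1))) + (4 * (d.2 * d.1) + 2))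

/-- Partial sums scaled by `2 ^ t` and the right end of the covered part scaled by
`2 ^ (n + t + 4)`, where `W t` is the `t`-th summand scaled by `2 ^ t`. -/
def coverState (W q : ℕ → ℕ) (n t : ℕ) : ℕ × ℕ :=
  Nat.rec (motive := fun _ => ℕ × ℕ) (0, 0) (fun t s => coverStep n s (W t, q t)) t

/-- The strings of length `n + t + 5` whose cylinders meet the interval covered at stage `t`. -/
def coverStage (W q : ℕ → ℕ) (n t : ℕ) : Set (List Bool) :=
  {σ | σ.length = n + t + 5 ∧
    (coverState W q n (t + 1)).2 - 2 * (4 * (q t * W t) + 2) ≤ binVal σ ∧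
    binVal σ ≤ (coverState W q n (t + 1)).2}

/-- The test that covers a sum with a computable acceleration. -/
def coverTest (W q : ℕ → ℕ) (n : ℕ) : Set (List Bool) := ⋃ t, coverStage W q n t

variable {W q : ℕ → ℕ} {w : ℕ → ℝ}

theorem coverState_fst (hW : ∀ t, (W t : ℝ) = 2 ^ t * w t) (n t : ℕ) :
    ((coverState W q n t).1 : ℝ) = 2 ^ t * ∑ s ∈ Finset.range t, w s := by
  induction t with
  | zero => simp [coverState]
  | succ t ih =>
    change ((2 * ((coverState W q n t).1 + W t) : ℕ) : ℝ) = _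
    push_cast
    rw [ih, hW, Finset.sum_range_succ]
    ring

/-- This explains the constants of `coverStep`: the jump `2^(-(n+3)) (q t * w t + 2^(-(t+1)))`,
measured in units of `2^(-(n+t+5))`, is the natural number `4 * (q t * W t) + 2`. -/
theorem coverState_snd (hW : ∀ t, (W t : ℝ) = 2 ^ t * w t) (n t : ℕ) :
    ((coverState W q n (t + 1)).2 : ℝ) / 2 ^ (n + (t + 1) + 4) =
      max (((coverState W q n t).2 : ℝ) / 2 ^ (n + t + 4)) (∑ s ∈ Finset.range (t + 1), w s) +
        (1 / 2) ^ (n + 3) * (q t * w t + (1 / 2) ^ (t + 1)) := by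
  have h₁ := coverState_fst (q := q) hW n (t + 1)
  have h₂ : (coverState W q n (t + 1)).2 = max (2 * (coverState W q n t).2)
    (2 ^ (n + 4) * (coverState W q n (t + 1)).1) + (4 * (q t * W t) + 2) := rfl
  rw [h₂]
  push_cast
  rw [h₁, hW, add_div, ← max_div_div_right (by positivity)]
  congr 1
  · congr 1
    · rw [show n + (t + 1) + 4 = n + t + 4 + 1 by ring, pow_succ]
      field_simp
    · rw [show n + (t + 1) + 4 = n + 4 + (t + 1) by ring, pow_add _ (n + 4)]
      field_simp
  · rw [show n + (t + 1) + 4 = n + 3 + (t + 1) + 1 by ring, one_div_pow, one_div_pow]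
    field_simp
    ring

theorem stringMeasure_coverTest_le (hW : ∀ t, (W t : ℝ) = 2 ^ t * w t)
    (hs : ∀ n, ∑ t ∈ Finset.range n, (q t : ℝ) * w t ≤ 1) (n : ℕ) :
    stringMeasure (coverTest W q n) ≤ (1 / 2) ^ n := by
  refine stringMeasure_iUnion_le
    (u := fun t => 3 * (1 / 2) ^ (n + 3) * (q t * w t + (1 / 2) ^ (t + 1))) (fun t => ?_) fun N => ?_
  · refine (stringMeasure_binVal_le _ _ _).trans ?_
    set R := (coverState W q n (t + 1)).2
    set L := 4 * (q t * W t) + 2 with hL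
    -- The window has at most `2 * L + 1` values, and `L ≥ 2`.
    have hn : R + 1 - (R - 2 * L) ≤ 3 * L := by omega
    have hLr : (L : ℝ) * (1 / 2) ^ (n + t + 5) =
        (1 / 2) ^ (n + 3) * (q t * w t + (1 / 2) ^ (t + 1)) := by
      rw [hL]
      push_cast
      rw [hW, show n + t + 5 = n + 3 + t + 2 by ring, one_div_pow, one_div_pow, one_div_pow]
      field_simp
      ring
    calc ((R + 1 - (R - 2 * L) : ℕ) : ℝ) * (1 / 2) ^ (n + t + 5)
        ≤ ((3 * L : ℕ) : ℝ) * (1 / 2) ^ (n + t + 5) := by gcongr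
      _ = 3 * (L * (1 / 2) ^ (n + t + 5)) := by push_cast; ring
      _ = _ := by rw [hLr]; ring
  · rw [← Finset.mul_sum, Finset.sum_add_distrib]
    have hg : ∑ t ∈ Finset.range N, (1 / 2 : ℝ) ^ (t + 1) ≤ 1 := by
      simp only [pow_succ, ← Finset.sum_mul]
      have := sum_geometric_two_le N
      linarith
    calc 3 * (1 / 2 : ℝ) ^ (n + 3) * _ ≤ 3 * (1 / 2 : ℝ) ^ (n + 3) * (1 + 1) := by
          gcongr
          exact hs N
      _ = 3 / 4 * (1 / 2) ^ n := by ring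
      _ ≤ _ := by linarith [show (0 : ℝ) < (1 / 2) ^ n by positivity]

theorem mem_cylinderSet_coverTest {X : ℕ → Bool} {α : ℝ} (hX : IsBinaryExpansion X α)
    (hW : ∀ t, (W t : ℝ) = 2 ^ t * w t) (hw : HasSum w α) (hw0 : ∀ t, 0 ≤ w t)
    (hq : ∀ k, ∃ T, ∀ t ≥ T, w t ≠ 0 → k ≤ q t) (n : ℕ) : X ∈ cylinderSet (coverTest W q n) := by
  have hq' : ∃ T, ∀ t ≥ T, w t ≤ (1 / 2) ^ (n + 3) * (q t * w t) := by
    obtain ⟨T, hT⟩ := hq (2 ^ (n + 3))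
    refine ⟨T, fun t ht => ?_⟩
    rcases (hw0 t).eq_or_lt with h | h
    · simp [← h]
    · have : (2 ^ (n + 3) : ℝ) ≤ q t := by exact_mod_cast hT t ht h.ne'
      calc w t = (1 / 2) ^ (n + 3) * (2 ^ (n + 3) * w t) := by
            rw [← mul_assoc, ← mul_pow]; norm_num
        _ ≤ _ := by gcongr
  obtain ⟨t, h₁, h₂⟩ := exists_capture (q := fun t => (q t : ℝ))
    (r := fun t => ((coverState W q n t).2 : ℝ) / 2 ^ (n + t + 4))
    (c := (1 / 2) ^ (n + 3)) hw hw0 (by positivity) hq' (fun _ => Nat.cast_nonneg _)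
    (by simp [coverState]) (coverState_snd hW n)
  have h₃ := coverState_snd (q := q) hW n t
  set R := (coverState W q n (t + 1)).2 with hR
  have hm : (0 : ℝ) < 2 ^ (n + t + 5) := by positivity
  rw [show n + (t + 1) + 4 = n + t + 5 by ring] at h₂ h₃
  obtain ⟨hb₁, hb₂⟩ := hX.binVal_bounds (n + t + 5)
  refine ⟨(List.range (n + t + 5)).map X, Set.mem_iUnion.2 ⟨t, by simp, ?_, ?_⟩,
    isInitSeg_range_map X _⟩
  · have hL : (2 : ℝ) ^ (n + t + 5) * ((1 / 2) ^ (n + 3) * (q t * w t + (1 / 2) ^ (t + 1))) =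
        ((4 * (q t * W t) + 2 : ℕ) : ℝ) := by
      push_cast
      rw [hW, show n + t + 5 = n + 3 + t + 2 by ring, one_div_pow, one_div_pow]
      field_simp
      ring
    have h₄ : (R : ℝ) - ((4 * (q t * W t) + 2 : ℕ) : ℝ) ≤ 2 ^ (n + t + 5) * α := by
      rw [← hL, ← mul_div_cancel₀ (R : ℝ) hm.ne', h₃, ← mul_sub, add_sub_cancel_right]
      gcongr
    rw [← hR]
    -- Cutting the expansion of `α` to an initial segment loses at most one unit. The doubled jump
    -- length in `coverStage` absorbs this loss.
    have h₅ : R ≤ binVal ((List.range (n + t + 5)).map X) + 1 + (4 * (q t * W t) + 2) := by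
      have : (R : ℝ) ≤ binVal ((List.range (n + t + 5)).map X) + 1 +
        ((4 * (q t * W t) + 2 : ℕ) : ℝ) := by linarith
      exact_mod_cast this
    omega
  · rw [lt_div_iff₀ hm] at h₂
    have : (binVal ((List.range (n + t + 5)).map X) : ℝ) ≤ R := by linarith
    exact_mod_cast this

theorem primrec_binVal : Primrec binVal := by
  have hb : Primrec Bool.toNat := Primrec.dom_bool _
  exact Primrec.list_foldl .id (.const 0) (Primrec.nat_add.comp
    (Primrec.nat_mul.comp (.const 2) (Primrec.fst.comp .snd))
    (hb.comp (Primrec.snd.comp .snd))).to₂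

theorem primrec_two_pow : Primrec fun n : ℕ => 2 ^ n :=
  (Primrec.nat_rec₁ 1 (Primrec.nat_mul.comp (.const 2) .snd).to₂).of_eq fun n => by
    induction n with
    | zero => rfl
    | succ n ih => simp only [ih, pow_succ']

theorem primrec_coverStep :
    Primrec fun x : ℕ × (ℕ × ℕ) × (ℕ × ℕ) => coverStep x.1 x.2.1 x.2.2 := by
  have hs : Primrec fun x : ℕ × (ℕ × ℕ) × (ℕ × ℕ) => x.2.1 := Primrec.fst.comp .snd
  have hd : Primrec fun x : ℕ × (ℕ × ℕ) × (ℕ × ℕ) => x.2.2 := Primrec.snd.comp .snd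
  have h₁ : Primrec fun x : ℕ × (ℕ × ℕ) × (ℕ × ℕ) => 2 * (x.2.1.1 + x.2.2.1) :=
    Primrec.nat_mul.comp (.const 2) (Primrec.nat_add.comp (Primrec.fst.comp hs) (Primrec.fst.comp hd))
  exact Primrec.pair h₁ (Primrec.nat_add.comp (Primrec.nat_max.comp
    (Primrec.nat_mul.comp (.const 2) (Primrec.snd.comp hs)) (Primrec.nat_mul.comp
      (primrec_two_pow.comp (Primrec.nat_add.comp .fst (.const 4))) h₁))
    (Primrec.nat_add.comp (Primrec.nat_mul.comp (.const 4)
      (Primrec.nat_mul.comp (Primrec.snd.comp hd) (Primrec.fst.comp hd))) (.const 2)))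

variable {O : Set (ℕ →. ℕ)}

theorem computableIn_coverState (hW : ComputableIn O W) (hq : ComputableIn O q) :
    ComputableIn O fun x : ℕ × ℕ => coverState W q x.1 x.2 := by
  have hy : ComputableIn O fun x : (ℕ × ℕ) × ℕ × (ℕ × ℕ) => x.2.1 :=
    (Computable.comp .fst .snd).computableIn
  have hn : ComputableIn O fun x : (ℕ × ℕ) × ℕ × (ℕ × ℕ) => x.1.1 :=
    (Computable.comp .fst .fst).computableIn
  have hs : ComputableIn O fun x : (ℕ × ℕ) × ℕ × (ℕ × ℕ) => x.2.2 :=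
    (Computable.comp .snd .snd).computableIn
  have hh : ComputableIn O fun x : (ℕ × ℕ) × ℕ × (ℕ × ℕ) =>
      coverStep x.1.1 x.2.2 (W x.2.1, q x.2.1) := by
    have h₁ := ComputableIn.pair (hW.comp hy) (hq.comp hy)
    have h₂ := ComputableIn.pair hn (ComputableIn.pair hs h₁)
    have h₃ := ComputableIn.comp_computable primrec_coverStep.to_comp h₂
    exact h₃
  have hz : ComputableIn O fun _ : ℕ × ℕ => ((0, 0) : ℕ × ℕ) := (Computable.const _).computableIn
  have h2 : ComputableIn O fun x : ℕ × ℕ => x.2 := Computable.snd.computableIn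
  have h := ComputableIn.nat_rec h2 hz hh
  exact h

/-- The length of a string fixes the only stage at which it can enter, so membership needs no
search. -/
theorem decIn_coverTest {A : Set ℕ} (hW : ComputableIn {charFun A} W)
    (hq : ComputableIn {charFun A} q) :
    DecIn A fun p : ℕ × List Bool => p.2 ∈ coverTest W q p.1 := by
  have ht : Primrec fun p : ℕ × List Bool => p.2.length - (p.1 + 5) :=
    Primrec.nat_sub.comp (Primrec.list_length.comp .snd) (Primrec.nat_add.comp .fst (.const 5))
  have htc := ht.to_comp.computableIn (O := {charFun A})
  have hS := (computableIn_coverState hW hq).comp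
    (Primrec.pair Primrec.fst (Primrec.succ.comp ht)).to_comp.computableIn
  have hdata := ComputableIn.pair (Computable.id.computableIn (α := ℕ × List Bool))
    (ComputableIn.pair hS (ComputableIn.pair (hW.comp htc) (hq.comp htc)))
  have hpred : PrimrecPred fun x : (ℕ × List Bool) × (ℕ × ℕ) × ℕ × ℕ =>
      x.1.1 + 5 ≤ x.1.2.length ∧ x.2.1.2 - 2 * (4 * (x.2.2.2 * x.2.2.1) + 2) ≤ binVal x.1.2 ∧
        binVal x.1.2 ≤ x.2.1.2 := by
    have hσ : Primrec fun x : (ℕ × List Bool) × (ℕ × ℕ) × ℕ × ℕ => x.1.2 := Primrec.snd.comp .fst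
    have hR : Primrec fun x : (ℕ × List Bool) × (ℕ × ℕ) × ℕ × ℕ => x.2.1.2 :=
      Primrec.snd.comp (Primrec.fst.comp .snd)
    have hd : Primrec fun x : (ℕ × List Bool) × (ℕ × ℕ) × ℕ × ℕ => x.2.2 := Primrec.snd.comp .snd
    refine PrimrecPred.and (Primrec.nat_le.comp (Primrec.nat_add.comp
      (Primrec.fst.comp .fst) (.const 5)) (Primrec.list_length.comp hσ)) (PrimrecPred.and
      (Primrec.nat_le.comp (Primrec.nat_sub.comp hR (Primrec.nat_mul.comp (.const 2)
        (Primrec.nat_add.comp (Primrec.nat_mul.comp (.const 4) (Primrec.nat_mul.comp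
          (Primrec.snd.comp hd) (Primrec.fst.comp hd))) (.const 2)))) (primrec_binVal.comp hσ))
      (Primrec.nat_le.comp (primrec_binVal.comp hσ) hR))
  refine ((DecIn.of_computablePred hpred.computablePred).comp hdata).of_eq fun p => ?_
  obtain ⟨n, σ⟩ := p
  simp only [coverTest, Set.mem_iUnion, coverStage, Set.mem_ofPred_eq, id]
  constructor
  · rintro ⟨h₁, h₂⟩
    exact ⟨σ.length - (n + 5), by omega, h₂⟩
  · rintro ⟨t, h₁, h₂⟩
    obtain rfl : σ.length - (n + 5) = t := by omega
    exact ⟨by omega, h₂⟩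

/-- The weight of an optional string scaled by `2 ^ t`. -/
def scaledWeight (t : ℕ) (o : Option (List Bool)) : ℕ := o.elim 0 fun σ => 2 ^ (t - σ.length)

/-- The length bound keeps the subtraction `t - σ.length` from being truncated, so natural number
arithmetic is exact. -/
theorem cast_scaledWeight {t : ℕ} {o : Option (List Bool)} (h : ∀ σ, o = some σ → σ.length ≤ t) :
    (scaledWeight t o : ℝ) = 2 ^ t * weight o := by
  rcases o with - | σ
  · simp [scaledWeight, weight]
  · obtain ⟨j, hj⟩ := Nat.exists_eq_add_of_le (h σ rfl)
    simp only [scaledWeight, weight, Option.elim_some]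
    rw [hj, Nat.add_sub_cancel_left, pow_add]
    push_cast
    rw [one_div_pow]
    field_simp

theorem primrec_scaledWeight :
    Primrec fun x : ℕ × Option (List Bool) => scaledWeight x.1 x.2 :=
  (Primrec.option_casesOn .snd (.const 0) (primrec_two_pow.comp (Primrec.nat_sub.comp
    (Primrec.fst.comp .fst) (Primrec.list_length.comp .snd))).to₂).of_eq fun x => by
      cases h : x.2 <;> simp [scaledWeight]

/-- The sum of the weights of an enumerated prefix-free set is not random if some computable
acceleration of the series has a bounded sum. -/
theorem not_isMLRandom_of_acceleration {A : Set ℕ} {f : ℕ → Option (List Bool)}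
    (hf : ComputableIn {charFun A} f) (hlen : ∀ t σ, f t = some σ → σ.length ≤ t)
    (hpf : PrefixFree f) (hq : ComputableIn {charFun A} q)
    (hs : ∀ n, ∑ t ∈ Finset.range n, (q t : ℝ) * weight (f t) ≤ 1)
    (hinf : ∀ k, ∃ T, ∀ t ≥ T, f t ≠ none → k ≤ q t) {X : ℕ → Bool}
    (hX : IsBinaryExpansion X (stringMeasure {σ | ∃ t, f t = some σ})) : ¬ IsMLRandom A X := by
  have hWc : ComputableIn {charFun A} fun t => scaledWeight t (f t) :=
    ComputableIn.comp_computable primrec_scaledWeight.to_comp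
      (ComputableIn.pair Computable.id.computableIn hf)
  have hW := fun t => cast_scaledWeight (hlen t)
  intro hrand
  obtain ⟨n, hn⟩ := hrand (coverTest (fun t => scaledWeight t (f t)) q)
    ⟨(decIn_coverTest hWc hq).ceIn, stringMeasure_coverTest_le hW hs⟩
  refine hn (mem_cylinderSet_coverTest hX hW hpf.hasSum (fun t => weight_nonneg _) (fun k => ?_) n)
  obtain ⟨T, hT⟩ := hinf k
  exact ⟨T, fun t ht h => hT t ht fun h' => h (by simp [h', weight])⟩

end Test

end InfSD

namespace InfSD

open Encodable

/-! ### An acceleration that the jump computes from the tails of a series. -/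

section Acceleration

/-- The tail of `∑ u` from `e` on is at most `2⁻ᵏ`. -/
def TailLE (u : ℕ → ℝ) (k e : ℕ) : Prop :=
  ∀ N, ∑ t ∈ Finset.range N, u (e + t) ≤ (1 / 2 : ℝ) ^ k

open Classical in
/-- The number of `k < e` such that the tail of `∑ u` from `e` on is at most `2⁻⁽ᵏ⁺¹⁾`. -/
noncomputable def tailCount (u : ℕ → ℝ) (e : ℕ) : ℕ :=
  ((Finset.range e).filter fun k => TailLE u (k + 1) e).card

variable {u : ℕ → ℝ}

theorem exists_le_tailCount (hu : Summable u) (hu0 : ∀ t, 0 ≤ u t) (k : ℕ) :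
    ∃ E, ∀ e ≥ E, k ≤ tailCount u e := by
  classical
  have hlt : ∑' t, u t - (1 / 2 : ℝ) ^ k < ∑' t, u t := by
    linarith [show (0 : ℝ) < (1 / 2) ^ k by positivity]
  obtain ⟨E, hE⟩ := Filter.eventually_atTop.1
    (hu.hasSum.tendsto_sum_nat.eventually (lt_mem_nhds hlt))
  -- `e ≥ k` is needed because `tailCount` counts only indices below `e`.
  refine ⟨max E k, fun e he => ?_⟩
  have hT : ∀ j < k, TailLE u (j + 1) e := fun j hj N => by
    have h₁ := hE e (le_trans (le_max_left _ _) he)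
    have h₂ := hu.sum_le_tsum (Finset.range (e + N)) fun t _ => hu0 t
    rw [Finset.sum_range_add] at h₂
    have h₃ : (1 / 2 : ℝ) ^ k ≤ (1 / 2) ^ (j + 1) :=
      pow_le_pow_of_le_one (by norm_num) (by norm_num) hj
    linarith
  calc k = (Finset.range k).card := (Finset.card_range k).symm
    _ ≤ _ := Finset.card_le_card fun j hj => by
      have hj' := Finset.mem_range.1 hj
      exact Finset.mem_filter.2
        ⟨Finset.mem_range.2 (hj'.trans_le (le_trans (le_max_right _ _) he)), hT j hj'⟩

/-- Exchange the summations over `e` and `k`. For fixed `k`, all qualifying `e` lie at or beyond the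
least one, whose tail is at most `2⁻⁽ᵏ⁺¹⁾`; these bounds add up to at most 1. -/
theorem sum_tailCount_mul_le (hu0 : ∀ t, 0 ≤ u t) (F : Finset ℕ) :
    ∑ e ∈ F, (tailCount u e : ℝ) * u e ≤ 1 := by
  classical
  obtain ⟨M, hM⟩ : ∃ M, ∀ e ∈ F, e < M :=
    ⟨F.sup id + 1, fun e he => Nat.lt_succ_of_le (Finset.le_sup (f := id) he)⟩
  have hin : ∀ k, ∑ e ∈ F.filter fun e => TailLE u (k + 1) e, u e ≤ (1 / 2 : ℝ) ^ (k + 1) := by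
    intro k
    rcases (F.filter fun e => TailLE u (k + 1) e).eq_empty_or_nonempty with h | h
    · rw [h, Finset.sum_empty]
      positivity
    · have hmin := Finset.min'_mem _ h
      set e₀ := Finset.min' _ h
      refine le_trans ?_ ((Finset.mem_filter.1 hmin).2 (M - e₀))
      rw [← Finset.sum_Ico_eq_sum_range]
      refine Finset.sum_le_sum_of_subset_of_nonneg (fun e he => ?_) fun e _ _ => hu0 e
      exact Finset.mem_Ico.2 ⟨Finset.min'_le _ _ he, hM e (Finset.mem_filter.1 he).1⟩
  have hcount : ∀ e ∈ F, (tailCount u e : ℝ) * u e ≤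
      ∑ k ∈ Finset.range M, if TailLE u (k + 1) e then u e else 0 := by
    intro e he
    rw [← Finset.sum_filter, Finset.sum_const, nsmul_eq_mul]
    refine mul_le_mul_of_nonneg_right ?_ (hu0 e)
    refine Nat.cast_le.2 (Finset.card_le_card (Finset.filter_subset_filter _ ?_))
    exact Finset.range_mono (hM e he).le
  calc _ ≤ _ := Finset.sum_le_sum hcount
    _ = ∑ k ∈ Finset.range M, ∑ e ∈ F.filter fun e => TailLE u (k + 1) e, u e := by
      rw [Finset.sum_comm]
      simp only [Finset.sum_filter]
    _ ≤ ∑ k ∈ Finset.range M, (1 / 2 : ℝ) ^ (k + 1) := Finset.sum_le_sum fun k _ => hin k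
    _ ≤ 1 := by
      simp only [pow_succ, ← Finset.sum_mul]
      linarith [sum_geometric_two_le M]

variable {A : Set ℕ}

open Classical in
theorem DecIn.count {α : Type*} [Primcodable α] {p : α × ℕ → Prop} (hp : DecIn A p) :
    ComputableIn {charFun A} fun x : α × ℕ =>
      ((Finset.range x.2).filter fun k => p (x.1, k)).card := by
  have hp' : DecIn A fun y : (α × ℕ) × ℕ × ℕ => p (y.1.1, y.2.1) :=
    hp.comp_computable (g := fun y : (α × ℕ) × ℕ × ℕ => (y.1.1, y.2.1))
      (.pair (.comp .fst .fst) (.comp .fst .snd))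
  have hi : ComputableIn {charFun A} fun y : (α × ℕ) × ℕ × ℕ => y.2.2 :=
    (Computable.comp .snd .snd).computableIn
  have hi' : ComputableIn {charFun A} fun y : (α × ℕ) × ℕ × ℕ => y.2.2 + 1 :=
    (Computable.succ.comp (Computable.comp .snd .snd)).computableIn
  have hh := hp'.ite hi' hi
  have hz : ComputableIn {charFun A} fun _ : α × ℕ => 0 := (Computable.const 0).computableIn
  have h2 : ComputableIn {charFun A} fun x : α × ℕ => x.2 := Computable.snd.computableIn
  have h := ComputableIn.nat_rec h2 hz hh
  refine h.of_eq ?_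
  rintro ⟨a, n⟩
  induction n with
  | zero => rfl
  | succ n ih =>
    simp only at ih ⊢
    rw [ih, Finset.range_add_one, Finset.filter_insert]
    split_ifs <;> simp

/-- The sum of `2 ^ (e + N) * weight (g (e + t))` over `t < N`. -/
def scaledTail (g : ℕ → Option (List Bool)) (e N : ℕ) : ℕ :=
  Nat.rec (motive := fun _ => ℕ) 0 (fun t s => 2 * (s + scaledWeight (e + t) (g (e + t)))) N

variable {g : ℕ → Option (List Bool)}

theorem cast_scaledTail (hg : ∀ t σ, g t = some σ → σ.length ≤ t) (e N : ℕ) :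
    (scaledTail g e N : ℝ) = 2 ^ (e + N) * ∑ t ∈ Finset.range N, weight (g (e + t)) := by
  induction N with
  | zero => simp [scaledTail]
  | succ N ih =>
    change ((2 * (scaledTail g e N + scaledWeight (e + N) (g (e + N))) : ℕ) : ℝ) = _
    push_cast
    rw [ih, cast_scaledWeight (hg (e + N)), Finset.sum_range_succ]
    ring

theorem computableIn_scaledTail (hg : ComputableIn {charFun A} g) :
    ComputableIn {charFun A} fun x : ℕ × ℕ => scaledTail g x.1 x.2 := by
  have ht : ComputableIn {charFun A} fun y : (ℕ × ℕ) × ℕ × ℕ => y.1.1 + y.2.1 :=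
    (Primrec.nat_add.comp (Primrec.fst.comp .fst) (Primrec.fst.comp .snd)).to_comp.computableIn
  have hi : ComputableIn {charFun A} fun y : (ℕ × ℕ) × ℕ × ℕ => y.2.2 :=
    (Computable.comp .snd .snd).computableIn
  have hw := ComputableIn.comp_computable primrec_scaledWeight.to_comp
    (ComputableIn.pair ht (hg.comp ht))
  have hs : Primrec fun y : ℕ × ℕ => 2 * (y.1 + y.2) :=
    Primrec.nat_mul.comp (.const 2) (Primrec.nat_add.comp .fst .snd)
  have hh := ComputableIn.comp_computable hs.to_comp (ComputableIn.pair hi hw)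
  have hz : ComputableIn {charFun A} fun _ : ℕ × ℕ => 0 := (Computable.const 0).computableIn
  have h2 : ComputableIn {charFun A} fun x : ℕ × ℕ => x.2 := Computable.snd.computableIn
  have h := ComputableIn.nat_rec h2 hz hh
  exact h

/-- After scaling, a tail bound is a universal statement about natural numbers computable in `A`,
hence decidable with one jump; the count is over finitely many `k`. -/
theorem computableIn_tailCount (hg : ComputableIn {charFun A} g)
    (hl : ∀ t σ, g t = some σ → σ.length ≤ t) :
    ComputableIn {charFun (haltingProblem A)} (tailCount fun t => weight (g t)) := by
  have hle : PrimrecPred fun y : ((ℕ × ℕ) × ℕ) × ℕ =>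
      2 ^ (y.1.1.2 + 1) * y.2 ≤ 2 ^ (y.1.1.1 + y.1.2) := by
    have h1 : Primrec fun y : ((ℕ × ℕ) × ℕ) × ℕ => y.1.1 := Primrec.fst.comp .fst
    exact Primrec.nat_le.comp (Primrec.nat_mul.comp
      (primrec_two_pow.comp (Primrec.succ.comp (Primrec.snd.comp h1))) .snd)
      (primrec_two_pow.comp (Primrec.nat_add.comp (Primrec.fst.comp h1) (Primrec.snd.comp .fst)))
  have hx : ComputableIn {charFun A} fun x : (ℕ × ℕ) × ℕ => (x.1.1, x.2) :=
    (Computable.pair (.comp .fst .fst) .snd).computableIn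
  have hs := (computableIn_scaledTail hg).comp hx
  have hid : ComputableIn {charFun A} fun x : (ℕ × ℕ) × ℕ => x := Computable.id.computableIn
  have hT := ((DecIn.of_computablePred hle.computablePred).comp (ComputableIn.pair hid hs)).forall_jump
  have hT' : DecIn (haltingProblem A) fun x : ℕ × ℕ => TailLE (fun t => weight (g t)) (x.2 + 1) x.1 := by
    refine hT.of_eq fun x => forall_congr' fun N => ?_
    simp only
    rw [← Nat.cast_le (α := ℝ)]
    push_cast
    rw [cast_scaledTail hl, mul_left_comm, mul_le_iff_le_one_right (by positivity), one_div_pow,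
      le_div_iff₀ (by positivity), mul_comm]
  have hd : ComputableIn {charFun (haltingProblem A)} fun e : ℕ => (e, e) :=
    (Computable.pair .id .id).computableIn
  have h := hT'.count.comp hd
  exact h

end Acceleration

/-! ### Enumerations of prefix-free sets and the main non-randomness result. -/

section Enumeration

variable {A : Set ℕ}

open Classical in
/-- The enumeration of `D` in which a string is listed at its code. -/
noncomputable def codeEnum (D : Set (List Bool)) (t : ℕ) : Option (List Bool) :=
  if (decode₂ (List Bool) t).getD [] ∈ D then decode₂ (List Bool) t else none

open Classical in
/-- The enumeration of `{σ | ∃ a, S (σ, a)}` in which `σ` is listed at `⟨σ, a⟩` if `S (σ, a)`. -/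
noncomputable def pairEnum (S : List Bool × ℕ → Prop) (t : ℕ) : Option (List Bool) :=
  if S ((decode₂ (List Bool) t.unpair.1).getD [], t.unpair.2) then decode₂ (List Bool) t.unpair.1
  else none

open Classical in
/-- The enumeration `f` without repetitions. -/
noncomputable def dedupEnum (f : ℕ → Option (List Bool)) (t : ℕ) : Option (List Bool) :=
  if ∃ s < t, f s = f t then none else f t

/-- `decode₂` accepts only genuine codes, so each string is listed exactly once. The default `[]` is
harmless: where `decode₂` fails, both branches are `none`. -/
theorem codeEnum_eq_some {D : Set (List Bool)} {t : ℕ} {σ : List Bool} :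
    codeEnum D t = some σ ↔ encode σ = t ∧ σ ∈ D := by
  unfold codeEnum
  split_ifs with h
  · rw [decode₂_eq_some]
    refine ⟨fun e => ⟨e, ?_⟩, And.left⟩
    rwa [decode₂_eq_some.2 e] at h
  · refine ⟨nofun, fun ⟨e, hσ⟩ => ?_⟩
    rw [decode₂_eq_some.2 e] at h
    exact absurd hσ h

theorem pairEnum_eq_some {S : List Bool × ℕ → Prop} {t : ℕ} {σ : List Bool} :
    pairEnum S t = some σ ↔ encode σ = t.unpair.1 ∧ S (σ, t.unpair.2) := by
  unfold pairEnum
  split_ifs with h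
  · rw [decode₂_eq_some]
    refine ⟨fun e => ⟨e, ?_⟩, And.left⟩
    rwa [decode₂_eq_some.2 e] at h
  · refine ⟨nofun, fun ⟨e, hσ⟩ => ?_⟩
    rw [decode₂_eq_some.2 e] at h
    exact absurd hσ h

theorem dedupEnum_eq_some {f : ℕ → Option (List Bool)} {t : ℕ} {σ : List Bool} :
    dedupEnum f t = some σ ↔ f t = some σ ∧ ∀ s < t, f s ≠ some σ := by
  unfold dedupEnum
  split_ifs with h
  · refine ⟨nofun, fun ⟨h₁, h₂⟩ => ?_⟩
    obtain ⟨s, hs, e⟩ := h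
    exact absurd (e.trans h₁) (h₂ s hs)
  · refine ⟨fun e => ⟨e, fun s hs h' => h ⟨s, hs, h'.trans e.symm⟩⟩, And.left⟩

theorem exists_dedupEnum_eq_some {f : ℕ → Option (List Bool)} {σ : List Bool} :
    (∃ t, dedupEnum f t = some σ) ↔ ∃ t, f t = some σ := by
  classical
  constructor
  · rintro ⟨t, h⟩
    exact ⟨t, (dedupEnum_eq_some.1 h).1⟩
  · intro h
    exact ⟨Nat.find h, dedupEnum_eq_some.2 ⟨Nat.find_spec h, fun s hs => Nat.find_min h hs⟩⟩

theorem prefixFree_dedupEnum {f : ℕ → Option (List Bool)}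
    (hf : ∀ s t σ τ, f s = some σ → f t = some τ → σ <+: τ → σ = τ) : PrefixFree (dedupEnum f) := by
  intro s t σ τ hs ht h
  obtain ⟨hs₁, hs₂⟩ := dedupEnum_eq_some.1 hs
  obtain ⟨ht₁, ht₂⟩ := dedupEnum_eq_some.1 ht
  obtain rfl := hf s t σ τ hs₁ ht₁ h
  rcases lt_trichotomy s t with h | h | h
  · exact absurd hs₁ (ht₂ s h)
  · exact h
  · exact absurd ht₁ (hs₂ t h)

theorem computableIn_codeEnum {D : Set (List Bool)} (hD : DecIn A (· ∈ D)) :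
    ComputableIn {charFun A} (codeEnum D) := by
  have hd : Primrec (decode₂ (List Bool)) := Primrec.decode₂
  have h₁ := hD.comp_computable (Primrec.option_getD.comp hd (.const [])).to_comp
  have h₂ := h₁.ite hd.to_comp.computableIn
    (Computable.const (none : Option (List Bool))).computableIn
  exact h₂

theorem computableIn_pairEnum {S : List Bool × ℕ → Prop} (hS : DecIn A S) :
    ComputableIn {charFun A} (pairEnum S) := by
  have hd : Primrec fun t : ℕ => decode₂ (List Bool) t.unpair.1 :=
    Primrec.decode₂.comp (Primrec.fst.comp .unpair)
  have h₁ := hS.comp_computable (Primrec.pair (Primrec.option_getD.comp hd (.const []))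
    (Primrec.snd.comp .unpair)).to_comp
  have h₂ := h₁.ite hd.to_comp.computableIn
    (Computable.const (none : Option (List Bool))).computableIn
  exact h₂

theorem computableIn_dedupEnum {f : ℕ → Option (List Bool)} (hf : ComputableIn {charFun A} f) :
    ComputableIn {charFun A} (dedupEnum f) := by
  have heq : PrimrecPred fun x : Option (List Bool) × Option (List Bool) => x.1 = x.2 :=
    Primrec.eq.comp .fst .snd
  have hs : ComputableIn {charFun A} fun x : ℕ × ℕ => f x.2 := hf.comp Computable.snd.computableIn
  have ht : ComputableIn {charFun A} fun x : ℕ × ℕ => f x.1 := hf.comp Computable.fst.computableIn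
  have h₁ := ((DecIn.of_computablePred heq.computablePred).comp (ComputableIn.pair hs ht)).exists_lt
  have h₂ := h₁.comp_computable (Computable.pair Computable.id Computable.id)
  refine (h₂.ite (Computable.const (none : Option (List Bool))).computableIn hf).of_eq fun t => ?_
  unfold dedupEnum
  congr

/-- If `D` is prefix-free and decidable relative to `A`, then the measure of a subset of `D` that is
c.e. relative to the jump of `A` is not random relative to the jump of `A`. -/
theorem not_isMLRandom_of_subset {D : Set (List Bool)} (hD : DecIn A (· ∈ D))
    (hpf : ∀ σ ∈ D, ∀ τ ∈ D, σ <+: τ → σ = τ) {S : List Bool × ℕ → Prop}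
    (hS : DecIn (haltingProblem A) S) (hSD : ∀ σ a, S (σ, a) → σ ∈ D) {X : ℕ → Bool}
    (hX : IsBinaryExpansion X (stringMeasure {σ | ∃ a, S (σ, a)})) :
    ¬ IsMLRandom (haltingProblem A) X := by
  classical
  set f := dedupEnum (pairEnum S) with hfdef
  have hf : ∀ t σ, f t = some σ → encode σ = t.unpair.1 ∧ σ ∈ D := fun t σ h => by
    obtain ⟨h₁, h₂⟩ := pairEnum_eq_some.1 (dedupEnum_eq_some.1 h).1
    exact ⟨h₁, hSD _ _ h₂⟩
  have hfpf : PrefixFree f := prefixFree_dedupEnum fun s t σ τ hs ht h => by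
    obtain ⟨-, h₁⟩ := pairEnum_eq_some.1 hs
    obtain ⟨-, h₂⟩ := pairEnum_eq_some.1 ht
    exact hpf σ (hSD _ _ h₁) τ (hSD _ _ h₂) h
  have hlenD : ∀ t σ, codeEnum D t = some σ → σ.length ≤ t := fun t σ h => by
    rw [← (codeEnum_eq_some.1 h).1]
    exact length_le_encode σ
  have hpfD : PrefixFree (codeEnum D) := fun s t σ τ hs ht h => by
    obtain ⟨rfl, h₁⟩ := codeEnum_eq_some.1 hs
    obtain ⟨rfl, h₂⟩ := codeEnum_eq_some.1 ht
    rw [hpf σ h₁ τ h₂ h]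
  -- The first component of a listing time is the code of the listed string. Injectivity means that
  -- each term of the series of `D` is charged at most once.
  have hinj : Set.InjOn (fun t : ℕ => t.unpair.1) {t | f t ≠ none} := fun s hs t ht h => by
    obtain ⟨σ, hσ⟩ := Option.ne_none_iff_exists'.1 hs
    obtain ⟨τ, hτ⟩ := Option.ne_none_iff_exists'.1 ht
    have : σ = τ := encode_injective ((hf s σ hσ).1.trans (h.trans (hf t τ hτ).1.symm))
    exact hfpf s t σ τ hσ hτ (this ▸ List.prefix_rfl)
  set u : ℕ → ℝ := fun t => weight (codeEnum D t)
  have hu0 : ∀ t, 0 ≤ u t := fun t => weight_nonneg _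
  have hfu : ∀ t, f t ≠ none → weight (f t) = u t.unpair.1 := fun t ht => by
    obtain ⟨σ, hσ⟩ := Option.ne_none_iff_exists'.1 ht
    simp only [u]
    rw [hσ, codeEnum_eq_some.2 (hf t σ hσ)]
  have hset : {σ | ∃ t, f t = some σ} = {σ | ∃ a, S (σ, a)} := by
    ext σ
    simp only [Set.mem_ofPred_eq, hfdef, exists_dedupEnum_eq_some, pairEnum_eq_some]
    constructor
    · rintro ⟨t, -, h⟩
      exact ⟨_, h⟩
    · rintro ⟨a, h⟩
      exact ⟨Nat.pair (encode σ) a, by simp, by simpa using h⟩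
  refine not_isMLRandom_of_acceleration (f := f) (q := fun t => tailCount u t.unpair.1)
    (computableIn_dedupEnum (computableIn_pairEnum hS)) (fun t σ h => ?_) hfpf
    ((computableIn_tailCount (computableIn_codeEnum hD) hlenD).comp
      (Computable.fst.comp .unpair).computableIn) (fun n => ?_) (fun k => ?_) (hset ▸ hX)
  · exact (length_le_encode σ).trans ((hf t σ h).1.trans_le (Nat.unpair_left_le t))
  · have h₁ : ∑ t ∈ Finset.range n, (tailCount u t.unpair.1 : ℝ) * weight (f t) =
        ∑ t ∈ (Finset.range n).filter (f · ≠ none), (tailCount u t.unpair.1 : ℝ) * u t.unpair.1 := by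
      rw [Finset.sum_filter]
      refine Finset.sum_congr rfl fun t _ => ?_
      split_ifs with h
      · rw [hfu t h]
      · simp [not_not.1 h, weight]
    -- Reindexing by codes turns this into a finite part of the accelerated series of `D`.
    rw [h₁, ← Finset.sum_image (f := fun e => (tailCount u e : ℝ) * u e)
      (g := fun t : ℕ => t.unpair.1)]
    · exact sum_tailCount_mul_le hu0 _
    · exact hinj.mono fun t ht => (Finset.mem_filter.1 ht).2
  · obtain ⟨E, hE⟩ := exists_le_tailCount hpfD.hasSum.summable hu0 k
    -- Only finitely many listed strings have a code below `E`, so after the last of them the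
    -- acceleration is at least `k` on listed strings.
    have hfin : {t | f t ≠ none ∧ t.unpair.1 < E}.Finite :=
      Set.Finite.of_finite_image ((Set.finite_lt_nat E).subset
        (by rintro _ ⟨t, ht, rfl⟩; exact ht.2)) (hinj.mono fun t ht => ht.1)
    obtain ⟨T, hT⟩ := hfin.bddAbove
    refine ⟨T + 1, fun t ht hne => hE _ ?_⟩
    by_contra hlt
    exact absurd (hT ⟨hne, not_le.1 hlt⟩) (by omega)

end Enumeration

end InfSD

namespace InfSD

/-! ### Application to infinitary self-delimiting machines. -/

namespace Machine

variable (M : Machine) {A : Set ℕ}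

theorem mem_dom_of_prefix {σ τ : List Bool} (h : σ <+: τ) (hσ : σ ∈ M.dom) : τ ∈ M.dom := by
  obtain ⟨ρ, rfl⟩ := h
  exact fun n => Part.dom_iff_mem.2 ⟨_, M.extend σ ρ n _ (Part.get_mem (hσ n))⟩

theorem decIn_dom : DecIn (haltingProblem A) (· ∈ M.dom) :=
  (DecIn.of_computablePred M.decidable_dom).forall_jump

/-- As the domain is closed under extensions, minimality needs testing only at the longest proper
prefix. The empty string is separate because its `dropLast` is itself. -/
theorem mem_minDom_iff {σ : List Bool} :
    σ ∈ M.minDom ↔ σ ∈ M.dom ∧ (σ = [] ∨ σ.dropLast ∉ M.dom) := by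
  refine and_congr_right fun _ => ⟨fun h => ?_, fun h τ hτ hd => ?_⟩
  · refine or_iff_not_imp_left.2 fun hne hd => hne ?_
    have := congrArg List.length (h _ σ.dropLast_prefix hd)
    rw [List.length_dropLast] at this
    exact List.length_eq_zero_iff.1 (by omega)
  · rcases h with rfl | h
    · exact List.prefix_nil.1 hτ
    · by_contra hne
      refine h (M.mem_dom_of_prefix (List.prefix_of_prefix_length_le hτ σ.dropLast_prefix ?_) hd)
      rw [List.length_dropLast]
      have := hτ.length_le.lt_of_ne fun e => hne (hτ.eq_of_length e)
      omega

theorem primrec_dropLast : Primrec fun σ : List Bool => σ.dropLast :=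
  (Primrec.list_reverse.comp (Primrec.list_tail.comp Primrec.list_reverse)).of_eq fun σ => by simp

theorem decIn_minDom : DecIn (haltingProblem A) (· ∈ M.minDom) := by
  have hnil : PrimrecPred fun σ : List Bool => σ = [] := Primrec.eq.comp .id (.const [])
  have h := M.decIn_dom (A := A) |>.and ((DecIn.of_computablePred hnil.computablePred).or
    (M.decIn_dom.comp_computable primrec_dropLast.to_comp).not)
  exact h.of_eq fun σ => M.mem_minDom_iff.symm

theorem eq_of_prefix_of_mem_minDom {σ τ : List Bool} (hσ : σ ∈ M.minDom) (hτ : τ ∈ M.minDom)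
    (h : σ <+: τ) : σ = τ := hτ.2 σ h hσ.1

theorem exists_prefix_mem_minDom {τ : List Bool} (hτ : τ ∈ M.dom) : ∃ σ ∈ M.minDom, σ <+: τ := by
  induction τ using List.reverseRecOn with
  | nil => exact ⟨[], M.mem_minDom_iff.2 ⟨hτ, .inl rfl⟩, List.prefix_rfl⟩
  | append_singleton τ b ih =>
    by_cases h : τ ∈ M.dom
    · obtain ⟨σ, hσ, hp⟩ := ih h
      exact ⟨σ, hσ, hp.trans (List.prefix_append _ _)⟩
    · exact ⟨_, M.mem_minDom_iff.2 ⟨hτ, .inr (by simpa using h)⟩, List.prefix_rfl⟩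

/-- A set of strings in the domain that is closed under taking prefixes in the domain has the same
measure as its part in the minimal domain. -/
theorem stringMeasure_inter_minDom {V : Set (List Bool)} (hV : V ⊆ M.dom)
    (hcl : ∀ σ τ : List Bool, σ <+: τ → σ ∈ M.dom → τ ∈ V → σ ∈ V) :
    stringMeasure (V ∩ M.minDom) = stringMeasure V := by
  have h : cylinderSet (V ∩ M.minDom) = cylinderSet V := by
    refine (cylinderSet_mono Set.inter_subset_left).antisymm ?_
    rintro X ⟨τ, hτ, hX⟩
    obtain ⟨σ, hσ, hp⟩ := M.exists_prefix_mem_minDom (hV hτ)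
    exact ⟨σ, ⟨hcl σ τ hp hσ.1 hτ, hσ⟩, hX.of_prefix hp⟩
  rw [stringMeasure, stringMeasure, h]

theorem not_isThreeRandom_of_decIn {V : Set (List Bool)} (hV : V ⊆ M.dom)
    (hcl : ∀ σ τ : List Bool, σ <+: τ → σ ∈ M.dom → τ ∈ V → σ ∈ V)
    {S : List Bool × ℕ → Prop} (hS : DecIn (iteratedHalting 2) S) (hVS : ∀ σ, σ ∈ V ↔ ∃ a, S (σ, a)) :
    ¬ IsThreeRandom (stringMeasure V) := by
  rintro ⟨X, hX, hrand⟩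
  have hD : DecIn (iteratedHalting 1) (· ∈ M.minDom) := M.decIn_minDom
  have hD' : DecIn (iteratedHalting 2) fun x : List Bool × ℕ => x.1 ∈ M.minDom :=
    hD.jump.comp_computable Computable.fst
  refine not_isMLRandom_of_subset (A := iteratedHalting 1) hD
    (fun σ hσ τ hτ => M.eq_of_prefix_of_mem_minDom hσ hτ) (hS.and hD') (fun σ a h => h.2) ?_ hrand
  rw [← M.stringMeasure_inter_minDom hV hcl] at hX
  convert hX using 2
  ext σ
  simp [hVS]

/-- By `extend`, the approximations on an extension of `σ` are those on `σ`. This gives the closure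
of `cofin` under prefixes in the domain. -/
theorem outputs_prefix {σ τ : List Bool} (h : σ <+: τ) (hσ : σ ∈ M.dom) {y : Outcome}
    (hτ : M.Outputs τ y) : M.Outputs σ y := by
  obtain ⟨ρ, rfl⟩ := h
  refine ⟨hσ, ?_⟩
  have : ∀ n, M.run (σ ++ ρ) n = M.run σ n := fun n => by
    have h₁ := M.extend σ ρ n _ (Part.get_mem (hσ n))
    rw [Part.eq_some_iff.2 h₁, Part.some_get]
  simpa only [this] using hτ.2

open Classical in
/-- The approximation `M(σ, n)`, with the value `[]` if it is undefined. -/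
noncomputable def approx (σ : List Bool) (n : ℕ) : List Bool :=
  if h : (M.run σ n).Dom then (M.run σ n).get h else []

theorem approx_eq_of_mem {σ u : List Bool} {n : ℕ} (h : u ∈ M.run σ n) : M.approx σ n = u := by
  rw [approx, dif_pos (Part.dom_iff_mem.2 ⟨u, h⟩), Part.get_eq_of_mem h]

theorem approx_mem {σ : List Bool} (hσ : σ ∈ M.dom) (n : ℕ) : M.approx σ n ∈ M.run σ n := by
  rw [approx, dif_pos (hσ n)]
  exact Part.get_mem _

theorem computable_approx : Computable fun p : List Bool × ℕ => M.approx p.1 p.2 := by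
  classical
  have h := Partrec.cond M.decidable_dom.decide M.partrec (Computable.const ([] : List Bool)).partrec
  refine h.of_eq_tot fun p => ?_
  by_cases hd : (M.run p.1 p.2).Dom
  · simp only [hd, decide_true, cond_true, approx, dif_pos]
    exact Part.get_mem _
  · simp [hd, approx]

theorem outputs_stream_iff {σ : List Bool} {Y : ℕ → Bool} : M.Outputs σ (.stream Y) ↔
    σ ∈ M.dom ∧ (∀ n, IsInitSeg (M.approx σ n) Y) ∧ ∀ k, ∃ n, k < (M.approx σ n).length := by
  refine and_congr_right fun hσ => ⟨fun h => ?_, fun ⟨h₁, h₂⟩ => ⟨?_, ?_⟩⟩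
  · have h₁ : ∀ n, IsInitSeg (M.approx σ n) Y := fun n => h.1 ⟨n, _, M.approx_mem hσ n, rfl⟩
    refine ⟨h₁, ?_⟩
    by_contra! hcon
    obtain ⟨k, hk⟩ := hcon
    -- If all lengths were at most `k`, the first `k` bits of `Y` would be an upper bound; but no
    -- stream lies below a string.
    have hub : Outcome.string ((List.range k).map Y) ∈
        upperBounds {z | ∃ n, ∃ u ∈ M.run σ n, z = Outcome.string u} := by
      rintro _ ⟨n, u, hu, rfl⟩
      rw [← M.approx_eq_of_mem hu]
      exact prefix_of_isInitSeg (h₁ n) (isInitSeg_range_map Y k) (by simpa using hk n)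
    exact h.2 hub
  · rintro _ ⟨n, u, hu, rfl⟩
    rw [← M.approx_eq_of_mem hu]
    exact h₁ n
  · intro z hz
    have hz' : ∀ n, Outcome.string (M.approx σ n) ≤ z := fun n => hz ⟨n, _, M.approx_mem hσ n, rfl⟩
    cases z with
    | string v =>
      obtain ⟨n, hn⟩ := h₂ v.length
      have : M.approx σ n <+: v := hz' n
      exact absurd this.length_le (by omega)
    | stream Z =>
      change Y = Z
      funext i
      obtain ⟨n, hn⟩ := h₂ i
      have : IsInitSeg (M.approx σ n) Z := hz' n
      rw [← h₁ n i hn, this i hn]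

/-- The default `Y i` makes positions past the end of `u` hold trivially, which leaves an unbounded
quantifier over a decidable equation, as `forall_jump` requires. -/
theorem isInitSeg_iff_getElem? {u : List Bool} {Y : ℕ → Bool} :
    IsInitSeg u Y ↔ ∀ i, u[i]?.getD (Y i) = Y i := by
  refine forall_congr' fun i => ⟨fun h => ?_, fun h hi => ?_⟩
  · by_cases hi : i < u.length
    · simp [hi, h hi]
    · simp [not_lt.1 hi]
  · simpa [hi] using h

/-- By `outputs_stream_iff`, outputting one given stream with a tail of 1s is a Π⁰₂ condition
relative to `A`. The quantifier over `τ` is then the only one left for `cofin`. -/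
theorem decIn_cofin : DecIn (haltingProblem (haltingProblem A)) fun p : List Bool × List Bool =>
    M.Outputs p.1 (.stream fun i => p.2.getD i true) := by
  have ha : Computable fun x : ((List Bool × List Bool) × ℕ) × ℕ => M.approx x.1.1.1 x.1.2 :=
    M.computable_approx.comp (g := fun x : ((List Bool × List Bool) × ℕ) × ℕ => (x.1.1.1, x.1.2))
      (.pair (.comp .fst (.comp .fst .fst)) (.comp .snd .fst))
  have ha' : Computable fun x : ((List Bool × List Bool) × ℕ) × ℕ => M.approx x.1.1.1 x.2 :=
    M.computable_approx.comp (g := fun x : ((List Bool × List Bool) × ℕ) × ℕ => (x.1.1.1, x.2))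
      (.pair (.comp .fst (.comp .fst .fst)) .snd)
  have hY : Computable fun x : ((List Bool × List Bool) × ℕ) × ℕ => x.1.1.2.getD x.2 true :=
    ((Primrec.list_getD true).comp (Primrec.snd.comp (Primrec.fst.comp .fst)) .snd).to_comp
  have heq : PrimrecPred fun x : Bool × Bool => x.1 = x.2 := Primrec.eq.comp .fst .snd
  have hlt : PrimrecPred fun x : ℕ × ℕ => x.1 < x.2 := Primrec.nat_lt.comp .fst .snd
  have hget := Computable.option_getD (Computable.list_getElem?.comp ha .snd) hY
  have h₁ := ((DecIn.of_computablePred (A := A) heq.computablePred).comp_computable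
    (Computable.pair hget hY)).forall_jump.forall_jump
  have h₂ := ((DecIn.of_computablePred (A := A) hlt.computablePred).comp_computable
    (Computable.pair (Computable.comp .snd .fst)
      (Computable.list_length.comp ha'))).exists_jump.forall_jump
  have hd := (M.decIn_dom (A := A)).jump.comp_computable
    (Computable.fst (α := List Bool) (β := List Bool))
  exact (hd.and (h₁.and h₂)).of_eq fun p => by
    simp only [M.outputs_stream_iff, isInitSeg_iff_getElem?]

theorem not_isThreeRandom_cofin : ¬ IsThreeRandom (stringMeasure M.cofin) := by
  have hc : Primrec fun x : List Bool × ℕ =>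
      (x.1, (Encodable.decode (α := List Bool) x.2).getD []) :=
    Primrec.pair .fst (Primrec.option_getD.comp (Primrec.decode.comp .snd) (.const []))
  have hS : DecIn (iteratedHalting 2) fun x : List Bool × ℕ => M.Outputs x.1
      (.stream fun i => ((Encodable.decode (α := List Bool) x.2).getD []).getD i true) := by
    have h := (M.decIn_cofin (A := iteratedHalting 0)).comp_computable hc.to_comp
    exact h
  refine M.not_isThreeRandom_of_decIn (fun σ ⟨τ, h⟩ => h.1)
    (fun σ τ h hσ ⟨ρ, hρ⟩ => ⟨ρ, M.outputs_prefix h hσ hρ⟩) hS fun σ => ⟨?_, fun ⟨a, h⟩ => ⟨_, h⟩⟩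
  rintro ⟨τ, h⟩
  exact ⟨Encodable.encode τ, by simpa using h⟩

theorem not_isThreeRandom_of_isSigma3 {V : Set (List Bool)} (hV : V ⊆ M.dom)
    (hcl : ∀ σ τ : List Bool, σ <+: τ → σ ∈ M.dom → τ ∈ V → σ ∈ V) (hS : IsSigma3 V) :
    ¬ IsThreeRandom (stringMeasure V) := by
  obtain ⟨R, hR, hVR⟩ := hS
  have hc : Computable fun x : ((List Bool × ℕ) × ℕ) × ℕ => (x.1.1.1, x.1.1.2, x.1.2, x.2) :=
    .pair (.comp .fst (.comp .fst .fst)) (.pair (.comp .snd (.comp .fst .fst))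
      (.pair (.comp .snd .fst) .snd))
  have h : DecIn (iteratedHalting 2) fun x : List Bool × ℕ => ∀ b, ∃ c, R x.1 x.2 b c :=
    ((DecIn.of_computablePred (A := iteratedHalting 0) hR).comp_computable
      hc).exists_jump.forall_jump
  exact M.not_isThreeRandom_of_decIn hV hcl h hVR

end Machine

end InfSD

theorem lemma1p3 (M : InfSD.Machine) :
    (∀ V : Set (List Bool), V ⊆ M.minDom → InfSD.IsSigma3 V →
      ¬ InfSD.IsThreeRandom (InfSD.stringMeasure V)) ∧
    (∀ V : Set (List Bool), V ⊆ M.dom → InfSD.IsSigma3 V →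
      (∀ σ τ : List Bool, σ <+: τ → σ ∈ M.dom → τ ∈ V → σ ∈ V) →
      ¬ InfSD.IsThreeRandom (InfSD.stringMeasure V)) ∧
    ¬ InfSD.IsThreeRandom (InfSD.stringMeasure M.cofin) := by
  refine ⟨fun V hV hS => ?_, fun V hV hS hcl => M.not_isThreeRandom_of_isSigma3 hV hcl hS,
    M.not_isThreeRandom_cofin⟩
  -- A set of minimal strings is closed under prefixes in the domain, since a minimal string has no
  -- proper ones.
  refine M.not_isThreeRandom_of_isSigma3 (fun σ hσ => (hV hσ).1) (fun σ τ h hσ hτ => ?_) hS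
  rwa [(hV hτ).2 σ h hσ]
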